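/- Let $D=[0,1]\times[0,1]$ and let $h^{\partial}:\partial D\to\mathbb R$ be a boundary condition such that $y\mapsto h^{\partial}(0,y)$ and $y\mapsto h^{\partial}(1,y)$ are constant, $x\mapsto h^{\partial}(x,0)$ and $x\mapsto h^{\partial}(x,1)$ are $\frac12$-Lipschitz on $[0,1]$, and $h^{\partial}(x,0)\le h^{\partial}(x,1)$ for all $x\in[0,1]$. Let $\mathcal H$ be the set of admissible functions, i.e. of functions $h:D\to\mathbb R$ such that $x\mapsto h(x,y)$ is $\frac12$-Lipschitz for every $y$, $y\mapsto h(x,y)$ is non-decreasing for every $x$, and $h=h^{\partial}$ on $\partial D$. *Rotated functions.* For $h\in\mathcal H$ consider the surface of all points $(x,y,z)$ with $(x,y)\in D$ and $h(x,y^-)\le z\le h(x,y^+)$, where $h(x,y^\pm)$ are the one-sided limits in $y$ (with $h(x,0^-)=h(x,0)$ and $h(x,1^+)=h(x,1)$). In the coordinates $$\tilde x=x,\qquad \tilde y=\tfrac{\sqrt2}{2}(y+z),\qquad \tilde z=\tfrac{\sqrt2}{2}(z-y),$$ this surface is the graph $\tilde z=\tilde h(\tilde x,\tilde y)$ of a function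 $\tilde h$ on $$\tilde D=\Big\{(\tilde x,\tilde y):0\le\tilde x\le1,\ \tfrac{\sqrt2}{2}h^{\partial}(\tilde x,0)\le\tilde y\le\tfrac{\sqrt2}{2}\big(1+h^{\partial}(\tilde x,1)\big)\Big\}.$$ Let $\tilde{\mathcal H}=\{\tilde h:h\in\mathcal H\}$. *Entropy.* For $(s,t)\in[-\frac12,\frac12]\times[0,\infty)$ put $ent(s,t)=0$ if $t=0$, $ent(s,t)=-\infty$ if $|s|=\frac12$ and $t\ne0$, and $ent(s,t)=\big(1+\ln\frac{\cos(\pi s)}{\pi t}\big)t$ otherwise. For a slope $(\tilde s,\tilde t)$ with $-1\le\tilde t\le1$ and $\sqrt2\,|\tilde s|\le\frac12(1-\tilde t)$ put $$\widetilde{ent}(\tilde s,\tilde t)=\tfrac{\sqrt2}{2}(1-\tilde t)\;ent\!\left(\frac{\sqrt2\,\tilde s}{1-\tilde t},\frac{1+\tilde t}{1-\tilde t}\right)\ \text{ if }\tilde t<1,\qquad \widetilde{ent}(\tilde s,1)=-\infty .$$ Each $\tilde h\in\tilde{\mathcal H}$ is differentiable almost everywhere in $\tilde D$, with slope in this range,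 and one defines, with values in $[-\infty,\infty)$, $$\widetilde{Ent}(\tilde h)=\iint_{\tilde D}\widetilde{ent}\Big(\frac{\partial\tilde h}{\partial\tilde x},\frac{\partial\tilde h}{\partial\tilde y}\Big)\,d\tilde x\,d\tilde y,\qquad Ent(h)=\widetilde{Ent}(\tilde h)\quad(h\in\mathcal H).$$ **Theorem.** There is a unique $h_0\in\mathcal H$ that maximizes $Ent$ over $\mathcal H$. Equivalently, there is a unique maximizer of $\widetilde{Ent}$ over $\tilde{\mathcal H}$, and it is $\tilde h_0$, the rotated function of $h_0$. -/

import Mathlib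

namespace BeadModel

/-- The boundary of the unit square. -/
def squareBoundary : Set (unitInterval × unitInterval) :=
  {p | p.1 = 0 ∨ p.1 = 1 ∨ p.2 = 0 ∨ p.2 = 1}

def bottomPt (x : unitInterval) : squareBoundary := ⟨(x, 0), by simp [squareBoundary]⟩

def topPt (x : unitInterval) : squareBoundary := ⟨(x, 1), by simp [squareBoundary]⟩

def leftPt (y : unitInterval) : squareBoundary := ⟨(0, y), by simp [squareBoundary]⟩

def rightPt (y : unitInterval) : squareBoundary := ⟨(1, y), by simp [squareBoundary]⟩

/-- Asymptotic boundary conditions that are constant on the left side and on the right side. -/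
structure IsBoundaryCondition (hb : squareBoundary → ℝ) : Prop where
  left_const : ∃ C₀ : ℝ, ∀ y, hb (leftPt y) = C₀
  right_const : ∃ C₁ : ℝ, ∀ y, hb (rightPt y) = C₁
  bottom_lipschitz : LipschitzWith (1 / 2) fun x => hb (bottomPt x)
  top_lipschitz : LipschitzWith (1 / 2) fun x => hb (topPt x)
  bottom_le_top : ∀ x, hb (bottomPt x) ≤ hb (topPt x)

/-- Admissible functions with boundary values `hb`. -/
structure IsAdmissible (hb : squareBoundary → ℝ) (h : unitInterval × unitInterval → ℝ) :
    Prop where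
  lipschitz : ∀ y, LipschitzWith (1 / 2) fun x => h (x, y)
  mono : ∀ x, Monotone fun y => h (x, y)
  boundary : ∀ p : squareBoundary, h p.1 = hb p

/-- The space of admissible functions. -/
def admissible (hb : squareBoundary → ℝ) : Set (unitInterval × unitInterval → ℝ) :=
  {h | IsAdmissible hb h}

/-- The surface of `h` in `ℝ³`, where every vertical jump is filled by a segment. The one-sided
limits are taken inside `[0, 1]`; at `y = 0` the left limit is by convention `h (x, 0)`, and at
`y = 1` the right limit is `h (x, 1)`. -/
def surface (h : unitInterval × unitInterval → ℝ) : Set (ℝ × ℝ × ℝ) :=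
  {p | ∃ x y : unitInterval, p.1 = x ∧ p.2.1 = y ∧
    Function.leftLim (fun y' => h (x, y')) y ≤ p.2.2 ∧
    p.2.2 ≤ Function.rightLim (fun y' => h (x, y')) y}

/-- The change of coordinates `(x, y, z) ↦ (x, (y + z) / √2, (z - y) / √2)`. -/
noncomputable def turn (p : ℝ × ℝ × ℝ) : ℝ × ℝ × ℝ :=
  (p.1, √2 / 2 * (p.2.1 + p.2.2), √2 / 2 * (p.2.2 - p.2.1))

/-- The domain of the turned functions. -/
def turnedDomain (hb : squareBoundary → ℝ) : Set (ℝ × ℝ) :=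
  {q | ∃ x : unitInterval, q.1 = x ∧ √2 / 2 * hb (bottomPt x) ≤ q.2 ∧
    q.2 ≤ √2 / 2 * (1 + hb (topPt x))}

/-- The function on the turned domain whose graph is the turned surface of `h`;
see `image_turn_surface`. -/
noncomputable def turned (hb : squareBoundary → ℝ) (h : unitInterval × unitInterval → ℝ) :
    turnedDomain hb → ℝ :=
  fun q => sSup {z | (q.1.1, q.1.2, z) ∈ turn '' surface h}

/-- The space of admissible functions in the turned coordinates. -/
def turnedAdmissible (hb : squareBoundary → ℝ) : Set (turnedDomain hb → ℝ) :=
  turned hb '' admissible hb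

/-- The local entropy function of the bead model, on `[-1/2, 1/2] × [0, ∞)`
(and `-∞` outside this set). -/
noncomputable def ent (s t : ℝ) : EReal :=
  if t < 0 ∨ 1 / 2 < |s| then ⊥
  else if t = 0 then 0
  else if |s| = 1 / 2 then ⊥
  else (((1 + Real.log (Real.cos (Real.pi * s) / (Real.pi * t))) * t : ℝ) : EReal)

/-- The local entropy in the turned coordinates: the Jacobian `√2 / 2 * (1 - t)` times the local
entropy at the slope of the original surface. It is `-∞` at the slope `t = 1`, which corresponds to
vertical pieces of the original surface. -/
noncomputable def turnedEnt (s t : ℝ) : EReal :=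
  if t = 1 then ⊥
  else ((√2 / 2 * (1 - t) : ℝ) : EReal) * ent (√2 * s / (1 - t)) ((1 + t) / (1 - t))

/-- Extension by `0`, used only to take derivatives at interior points of the domain. -/
noncomputable def extendZero {U : Set (ℝ × ℝ)} (g : U → ℝ) (p : ℝ × ℝ) : ℝ :=
  open Classical in if hp : p ∈ U then g ⟨p, hp⟩ else 0

/-- The partial derivatives on the domain. -/
noncomputable def partialX {U : Set (ℝ × ℝ)} (g : U → ℝ) (p : ℝ × ℝ) : ℝ :=
  deriv (fun x => extendZero g (x, p.2)) p.1

noncomputable def partialY {U : Set (ℝ × ℝ)} (g : U → ℝ) (p : ℝ × ℝ) : ℝ :=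
  deriv (fun y => extendZero g (p.1, y)) p.2

/-- The Lebesgue integral over `U` of an extended real function with integrable positive part:
the integral of the positive part minus the integral of the negative part. -/
noncomputable def integralEReal (U : Set (ℝ × ℝ)) (f : ℝ × ℝ → EReal) : EReal :=
  ((∫⁻ p in U, (f p).toENNReal : ENNReal) : EReal) -
    ((∫⁻ p in U, (-f p).toENNReal : ENNReal) : EReal)

/-- The entropy of a function on the turned domain. -/
noncomputable def turnedEntropy {hb : squareBoundary → ℝ} (g : turnedDomain hb → ℝ) : EReal :=
  integralEReal (turnedDomain hb) fun p => turnedEnt (partialX g p) (partialY g p)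

/-- The entropy of an admissible function. -/
noncomputable def entropy (hb : squareBoundary → ℝ) (h : unitInterval × unitInterval → ℝ) : EReal :=
  turnedEntropy (turned hb h)

/-- A nondecreasing function on `[0, 1]` with filled jumps meets every antidiagonal line
`y + z = c` with `f 0 ≤ c ≤ 1 + f 1`. -/
theorem exists_filled_graph {f : unitInterval → ℝ} (hf : Monotone f) {c : ℝ}
    (h0 : f 0 ≤ c) (h1 : c ≤ 1 + f 1) :
    ∃ y : unitInterval, Function.leftLim f y ≤ c - y ∧ c - y ≤ Function.rightLim f y := by
  set A : Set unitInterval := {y | (y : ℝ) + f y ≤ c} with hA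
  have hcont : Filter.Tendsto (fun y : unitInterval => c - (y : ℝ)) (nhds (sSup A))
      (nhds (c - (sSup A : unitInterval))) :=
    (continuous_const.sub continuous_subtype_val).tendsto _
  refine ⟨sSup A, ?_, ?_⟩
  · rcases eq_or_lt_of_le (unitInterval.nonneg' (t := sSup A)) with hs | hs
    · rw [← hs, leftLim_eq_of_isBot (fun y => unitInterval.nonneg')]
      simpa using h0
    · have hne : (nhdsWithin (sSup A) (Set.Iio (sSup A))).NeBot :=
        nhdsLT_neBot_of_exists_lt ⟨0, hs⟩
      refine le_of_tendsto_of_tendsto (hf.tendsto_leftLim (sSup A))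
        (hcont.mono_left nhdsWithin_le_nhds) ?_
      filter_upwards [self_mem_nhdsWithin] with y hy
      obtain ⟨a, ha, hya⟩ := lt_sSup_iff.1 (Set.mem_Iio.1 hy)
      have h2 : (a : ℝ) + f a ≤ c := ha
      have h3 : (y : ℝ) < a := hya
      have h4 := hf hya.le
      linarith
  · rcases eq_or_lt_of_le (unitInterval.le_one' (t := sSup A)) with hs | hs
    · rw [hs, rightLim_eq_of_isTop (fun y => unitInterval.le_one')]
      simp only [Set.Icc.coe_one]
      linarith
    · have hne : (nhdsWithin (sSup A) (Set.Ioi (sSup A))).NeBot :=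
        nhdsGT_neBot_of_exists_gt ⟨1, hs⟩
      refine le_of_tendsto_of_tendsto (hcont.mono_left nhdsWithin_le_nhds)
        (hf.tendsto_rightLim (sSup A)) ?_
      filter_upwards [self_mem_nhdsWithin] with y hy
      have h2 : y ∉ A := fun h => absurd (le_sSup h) (not_le.2 hy)
      have h3 : c < (y : ℝ) + f y := by simpa [hA] using h2
      linarith

/-- Such a point is unique. -/
theorem filled_graph_unique {f : unitInterval → ℝ} (hf : Monotone f) {y y' : unitInterval}
    {z z' : ℝ} (hz : z ≤ Function.rightLim f y) (hz' : Function.leftLim f y' ≤ z')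
    (h : (y : ℝ) + z = y' + z') : y' ≤ y := by
  by_contra hlt
  have h1 := hf.rightLim_le_leftLim (not_le.1 hlt)
  have h2 : (y : ℝ) < y' := not_le.1 hlt
  linarith

/-- For an admissible `h`, the turned surface is exactly the graph of `turned hb h`. -/
theorem image_turn_surface {hb : squareBoundary → ℝ} {h : unitInterval × unitInterval → ℝ}
    (hh : h ∈ admissible hb) :
    turn '' surface h =
      {p | ∃ hq : (p.1, p.2.1) ∈ turnedDomain hb, p.2.2 = turned hb h ⟨(p.1, p.2.1), hq⟩} := by
  have h22 : √2 / 2 * √2 = 1 := by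
    have := Real.mul_self_sqrt (show (0 : ℝ) ≤ 2 by norm_num)
    linarith
  have hpos : (0 : ℝ) < √2 / 2 := by positivity
  have hbot : ∀ x, h (x, 0) = hb (bottomPt x) := fun x => hh.boundary (bottomPt x)
  have htop : ∀ x, h (x, 1) = hb (topPt x) := fun x => hh.boundary (topPt x)
  have hdom : ∀ p ∈ turn '' surface h, (p.1, p.2.1) ∈ turnedDomain hb := by
    rintro _ ⟨⟨a, b, z⟩, ⟨x, y, rfl, rfl, hl, hr⟩, rfl⟩
    refine ⟨x, rfl, ?_, ?_⟩
    · refine mul_le_mul_of_nonneg_left ?_ hpos.le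
      have h1 : h (x, 0) ≤ Function.leftLim (fun y' => h (x, y')) y := by
        rw [← leftLim_eq_of_isBot (f := fun y' => h (x, y'))
          (fun y => unitInterval.nonneg' : IsBot (0 : unitInterval))]
        exact (hh.mono x).leftLim unitInterval.nonneg'
      have h2 : (0 : ℝ) ≤ y := y.2.1
      rw [← hbot]
      simp only at hl ⊢
      linarith
    · refine mul_le_mul_of_nonneg_left ?_ hpos.le
      have h1 : Function.rightLim (fun y' => h (x, y')) y ≤ h (x, 1) := by
        rw [← rightLim_eq_of_isTop (f := fun y' => h (x, y'))
          (fun y => unitInterval.le_one' : IsTop (1 : unitInterval))]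
        exact (hh.mono x).rightLim unitInterval.le_one'
      have h2 : (y : ℝ) ≤ 1 := y.2.2
      rw [← htop]
      simp only at hr ⊢
      linarith
  have huniq : ∀ a b z z', (a, b, z) ∈ turn '' surface h → (a, b, z') ∈ turn '' surface h →
      z = z' := by
    rintro a b z z' ⟨⟨_, _, w⟩, ⟨x, y, rfl, rfl, hl, hr⟩, he⟩
      ⟨⟨_, _, w'⟩, ⟨x', y', rfl, rfl, hl', hr'⟩, he'⟩
    simp only [turn, Prod.mk.injEq] at he he' hl hr hl' hr'
    obtain ⟨e1, e2, e3⟩ := he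
    obtain ⟨e1', e2', e3'⟩ := he'
    obtain rfl : x = x' := Subtype.ext (e1.trans e1'.symm)
    have hs : (y : ℝ) + w = y' + w' := mul_left_cancel₀ hpos.ne' (e2.trans e2'.symm)
    obtain rfl : y = y' := le_antisymm (filled_graph_unique (hh.mono x) hr' hl hs.symm)
      (filled_graph_unique (hh.mono x) hr hl' hs)
    obtain rfl : w = w' := by linarith
    exact e3.symm.trans e3'
  have hexists : ∀ q ∈ turnedDomain hb, ∃ z, (q.1, q.2, z) ∈ turn '' surface h := by
    rintro ⟨a, b⟩ ⟨x, hx, h0, h1⟩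
    simp only at hx h0 h1
    subst hx
    rw [← hbot] at h0
    rw [← htop] at h1
    have hb' : √2 / 2 * (√2 * b) = b := by rw [← mul_assoc, h22, one_mul]
    obtain ⟨y, hl, hr⟩ := exists_filled_graph (hh.mono x) (c := √2 * b)
      (le_of_mul_le_mul_left (by rw [hb']; exact h0) hpos)
      (le_of_mul_le_mul_left (by rw [hb']; exact h1) hpos)
    refine ⟨√2 / 2 * (√2 * b - y - y), ((x : ℝ), (y : ℝ), √2 * b - y), ⟨x, y, rfl, rfl, hl, hr⟩, ?_⟩
    simp only [turn, Prod.mk.injEq, true_and, and_true]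
    rw [add_sub_cancel, hb']
  have hturned : ∀ a b z, ∀ hq : (a, b) ∈ turnedDomain hb, (a, b, z) ∈ turn '' surface h →
      turned hb h ⟨(a, b), hq⟩ = z := by
    intro a b z hq hz
    have : {w | (a, b, w) ∈ turn '' surface h} = {z} :=
      Set.eq_singleton_iff_unique_mem.2 ⟨hz, fun w hw => huniq a b w z hw hz⟩
    simp only [turned, this, csSup_singleton]
  ext ⟨a, b, z⟩
  constructor
  · intro hp
    exact ⟨hdom _ hp, (hturned a b z (hdom _ hp) hp).symm⟩
  · rintro ⟨hq, hz⟩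
    obtain ⟨w, hw⟩ := hexists _ hq
    have h1 := hturned a b w hq hw
    simp only at hz
    rw [hz, h1]
    exact hw

end BeadModel

open MeasureTheory Filter Topology Set
open scoped ENNReal NNReal Interval

namespace BeadModel

/-! The surface of `h` is encoded by its profile `Y (x, w)`, the `y`-coordinate of the surface point
with rotated coordinates `(x, w)`; the rotated function is `w - √2 Y`. Monotonicity of `h` in `y`
makes `Y` `√2`-Lipschitz in `w`. Together with the Lipschitz bound in `x` it makes `Y` nondecreasing
along the directions of a cone. Both constraints are convex in `Y` and closed under pointwise
limits, and every `Y` satisfying them is Lipschitz.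

In terms of the slope `(p, q)` of `Y`, put `C = q cos (√2 π p / q)` and `T = √2 - q`. The rotated
local entropy is `T (1 + log (C / (π T)))`, and `cost` is 1 minus it. Since `cost` is the supremum
over `v > 0` of `1 - v C / π + T log v`, and `C` is concave in `(p, q)`, the cost is convex and
lower semicontinuous. It is nonnegative because `C ≤ √2 < π`. Maximizing the entropy thus means
minimizing `totalCost`, the entropy being the finite area of the domain minus this cost
(`entropy_eq`).

Existence (`exists_totalCost_minimal`): among almost minimizers, those whose gradients have almost
least `L²` norm have strongly converging gradients, by the parallelogram law. Fatou's lemma then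
gives a minimizer. Uniqueness: at finite cost the midpoint inequality is strict as soon as the two
values of `q` differ (`cost_midpoint_lt`), so two minimizers have the same `∂Y/∂w` almost
everywhere. Both vanish on the lower boundary curve, hence they coincide (`eq_of_gradY_ae_eq`).

To return from profiles to functions, `profileHeight` inverts `Y` in `w`. A profile determines `h`
except at jumps in `y`, where `Y` is flat in `w`. A flat piece would be flat on an open diamond,
where the cost is infinite (`IsProfile.lt_of_totalCost_ne_top`). The argument therefore needs one
profile of finite cost (`exists_totalCost_ne_top`). It comes from interpolating linearly between the
boundary curves and a middle curve whose slope stays away from `±1/2` in proportion to the gap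
between them. Its cost has only logarithmic singularities at the boundary. -/

/-! ### Concavity of the perspective of the cosine -/

/-- The perspective `q cos (√2 π p / q)` of the cosine. -/
noncomputable def perspCos (p q : ℝ) : ℝ := q * Real.cos (√2 * Real.pi * p / q)

theorem sqrt_two_mul_self : √2 * √2 = 2 := Real.mul_self_sqrt (by norm_num)

theorem sqrt_two_pos : 0 < √2 := by positivity

theorem sqrt_two_lt_two : √2 < 2 := by
  nlinarith [sqrt_two_mul_self, sqrt_two_pos]

theorem angle_mem_Icc {p q : ℝ} (hq : 0 < q) (h : 2 * √2 * |p| ≤ q) :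
    √2 * Real.pi * p / q ∈ Icc (-(Real.pi / 2)) (Real.pi / 2) := by
  have hp := Real.pi_pos
  have h1 : |√2 * Real.pi * p / q| ≤ Real.pi / 2 := by
    rw [abs_div, abs_mul, abs_of_pos hq, abs_of_pos (by positivity : 0 < √2 * Real.pi),
      div_le_iff₀ hq]
    nlinarith
  exact abs_le.1 h1

theorem nonneg_of_cone {p q : ℝ} (h : 2 * √2 * |p| ≤ q) : 0 ≤ q :=
  le_trans (by positivity) h

theorem eq_zero_of_cone {p : ℝ} (h : 2 * √2 * |p| ≤ 0) : p = 0 := by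
  have h2 : 0 < 2 * √2 := by positivity
  have : |p| ≤ 0 := by nlinarith [abs_nonneg p]
  exact abs_nonpos_iff.1 this

theorem perspCos_nonneg {p q : ℝ} (h : 2 * √2 * |p| ≤ q) : 0 ≤ perspCos p q := by
  rcases (nonneg_of_cone h).eq_or_lt with hq | hq
  · simp [perspCos, ← hq]
  · exact mul_nonneg hq.le (Real.cos_nonneg_of_mem_Icc (angle_mem_Icc hq h))

theorem perspCos_le {p q : ℝ} (hq : 0 ≤ q) : perspCos p q ≤ q :=
  mul_le_of_le_one_right hq (Real.cos_le_one _)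

/-- Jordan's inequality `cos θ ≥ 1 - 2 |θ| / π`. It serves the finite-cost example, where the
distance of the slope to the edge of the cone is controlled. -/
theorem sub_le_perspCos {p q : ℝ} (h : 2 * √2 * |p| ≤ q) : q - 2 * √2 * |p| ≤ perspCos p q := by
  rcases (nonneg_of_cone h).eq_or_lt with hq | hq
  · subst hq
    simp [perspCos]
  · obtain ⟨h1, h2⟩ := angle_mem_Icc hq h
    have h3 := Real.one_sub_mul_le_cos (x := |√2 * Real.pi * p / q|) (abs_nonneg _)
      (abs_le.2 ⟨h1, h2⟩)
    rw [Real.cos_abs] at h3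
    have h4 : |√2 * Real.pi * p / q| = √2 * Real.pi * |p| / q := by
      rw [abs_div, abs_mul, abs_of_pos hq,
        abs_of_pos (by have := Real.pi_pos; positivity : 0 < √2 * Real.pi)]
    rw [h4] at h3
    have h5 : q * (1 - 2 / Real.pi * (√2 * Real.pi * |p| / q)) ≤ perspCos p q :=
      mul_le_mul_of_nonneg_left h3 hq.le
    have h6 : q * (1 - 2 / Real.pi * (√2 * Real.pi * |p| / q)) = q - 2 * √2 * |p| := by
      have := Real.pi_pos.ne'
      field_simp
    linarith

theorem perspCos_half (p q : ℝ) : perspCos (p / 2) (q / 2) = perspCos p q / 2 := by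
  unfold perspCos
  rcases eq_or_ne q 0 with rfl | hq
  · simp
  · have : √2 * Real.pi * (p / 2) / (q / 2) = √2 * Real.pi * p / q := by field_simp
    rw [this]; ring

theorem angle_add {p₁ q₁ p₂ q₂ : ℝ} (hq₁ : 0 < q₁) (hq₂ : 0 < q₂) :
    √2 * Real.pi * (p₁ + p₂) / (q₁ + q₂) =
      (q₁ / (q₁ + q₂)) • (√2 * Real.pi * p₁ / q₁) + (q₂ / (q₁ + q₂)) • (√2 * Real.pi * p₂ / q₂) := by
  simp only [smul_eq_mul]
  field_simp

/-- The angle of the sum is the average of the angles with weights `qᵢ / (q₁ + q₂)`, so this is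
concavity of the cosine on `[-π/2, π/2]`. At the apex `q = 0` the cone forces `p = 0`. -/
theorem perspCos_add_le {p₁ q₁ p₂ q₂ : ℝ} (h₁ : 2 * √2 * |p₁| ≤ q₁) (h₂ : 2 * √2 * |p₂| ≤ q₂) :
    perspCos p₁ q₁ + perspCos p₂ q₂ ≤ perspCos (p₁ + p₂) (q₁ + q₂) := by
  rcases (nonneg_of_cone h₁).eq_or_lt with hq | hq₁
  · subst hq
    simp [eq_zero_of_cone h₁, perspCos]
  rcases (nonneg_of_cone h₂).eq_or_lt with hq | hq₂
  · subst hq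
    simp [eq_zero_of_cone h₂, perspCos]
  have hs : 0 < q₁ + q₂ := by positivity
  have h := strictConcaveOn_cos_Icc.concaveOn.2 (angle_mem_Icc hq₁ h₁) (angle_mem_Icc hq₂ h₂)
    (show 0 ≤ q₁ / (q₁ + q₂) by positivity) (show 0 ≤ q₂ / (q₁ + q₂) by positivity)
    (by field_simp)
  rw [← angle_add hq₁ hq₂] at h
  have h3 := mul_le_mul_of_nonneg_left h hs.le
  refine le_trans (le_of_eq ?_) h3
  simp only [perspCos, smul_eq_mul]
  field_simp

theorem perspCos_add_lt {p₁ q₁ p₂ q₂ : ℝ} (h₁ : 2 * √2 * |p₁| ≤ q₁) (h₂ : 2 * √2 * |p₂| ≤ q₂)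
    (hq₁ : 0 < q₁) (hq₂ : 0 < q₂) (hne : √2 * Real.pi * p₁ / q₁ ≠ √2 * Real.pi * p₂ / q₂) :
    perspCos p₁ q₁ + perspCos p₂ q₂ < perspCos (p₁ + p₂) (q₁ + q₂) := by
  have hs : 0 < q₁ + q₂ := by positivity
  have h := strictConcaveOn_cos_Icc.2 (angle_mem_Icc hq₁ h₁) (angle_mem_Icc hq₂ h₂) hne
    (show 0 < q₁ / (q₁ + q₂) by positivity) (show 0 < q₂ / (q₁ + q₂) by positivity)
    (by field_simp)
  rw [← angle_add hq₁ hq₂] at h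
  have h3 := mul_lt_mul_of_pos_left h hs
  refine lt_of_eq_of_lt ?_ h3
  simp only [perspCos, smul_eq_mul]
  field_simp

theorem perspCos_midpoint {p₁ q₁ p₂ q₂ : ℝ} (h₁ : 2 * √2 * |p₁| ≤ q₁) (h₂ : 2 * √2 * |p₂| ≤ q₂) :
    (perspCos p₁ q₁ + perspCos p₂ q₂) / 2 ≤ perspCos ((p₁ + p₂) / 2) ((q₁ + q₂) / 2) := by
  rw [perspCos_half]
  linarith [perspCos_add_le h₁ h₂]

/-! ### The cost as a supremum: convexity, strictness, semicontinuity -/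

/-- The members of the family whose supremum is the cost; each is affine in `C` and `T`. -/
noncomputable def costLine (v C T : ℝ) : ℝ := 1 - v / Real.pi * C + T * Real.log v

noncomputable def costReal (C T : ℝ) : ℝ := 1 - T * (1 + Real.log (C / (Real.pi * T)))

theorem costLine_optimal {C T : ℝ} (hC : 0 < C) :
    costLine (Real.pi * T / C) C T = costReal C T := by
  have hp := Real.pi_pos
  have : Real.log (C / (Real.pi * T)) = - Real.log (Real.pi * T / C) := by
    rw [← Real.log_inv, inv_div]
  rw [costLine, costReal, this]
  field_simp
  ring

/-- This is `log u ≤ u - 1` at `u = v C / (π T)`, multiplied by `T`. Equality requires `u = 1`,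
which is the content of `mul_eq_of_costLine_eq`. -/
theorem costLine_le_costReal {v C T : ℝ} (hv : 0 < v) (hC : 0 ≤ C) (hT : 0 ≤ T)
    (h : T = 0 ∨ 0 < C) : costLine v C T ≤ costReal C T := by
  have hp := Real.pi_pos
  rcases hT.eq_or_lt with rfl | hT
  · simp only [costLine, costReal, zero_mul, add_zero, sub_zero]
    have : 0 ≤ v / Real.pi * C := by positivity
    linarith
  · have hC : 0 < C := h.resolve_left hT.ne'
    have h1 := Real.log_le_sub_one_of_pos (show 0 < v * C / (Real.pi * T) by positivity)
    have h2 : Real.log (v * C / (Real.pi * T)) = Real.log v + Real.log (C / (Real.pi * T)) := by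
      rw [mul_div_assoc, Real.log_mul hv.ne' (by positivity)]
    have h3 := mul_le_mul_of_nonneg_left h1 hT.le
    have h4 : T * (v * C / (Real.pi * T) - 1) = v / Real.pi * C - T := by field_simp
    rw [h4, h2] at h3
    simp only [costLine, costReal]
    linarith

theorem mul_eq_of_costLine_eq {v C T : ℝ} (hv : 0 < v) (hT : 0 ≤ T)
    (h : T = 0 ∨ 0 < C) (he : costLine v C T = costReal C T) : v * C = Real.pi * T := by
  have hp := Real.pi_pos
  rcases hT.eq_or_lt with rfl | hT
  · simp only [costLine, costReal, zero_mul, add_zero, sub_zero] at he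
    have h1 : v / Real.pi * C = 0 := by linarith
    have h2 : v * C = Real.pi * (v / Real.pi * C) := by field_simp
    rw [h2, h1]
  · have hC : 0 < C := h.resolve_left hT.ne'
    by_contra hne
    have h1 := Real.log_lt_sub_one_of_pos (show 0 < v * C / (Real.pi * T) by positivity)
      (fun h => hne (by rwa [div_eq_one_iff_eq (by positivity)] at h))
    have h2 : Real.log (v * C / (Real.pi * T)) = Real.log v + Real.log (C / (Real.pi * T)) := by
      rw [mul_div_assoc, Real.log_mul hv.ne' (by positivity)]
    have h3 := mul_lt_mul_of_pos_left h1 hT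
    have h4 : T * (v * C / (Real.pi * T) - 1) = v / Real.pi * C - T := by field_simp
    rw [h4, h2] at h3
    simp only [costLine, costReal] at he
    linarith

open Classical in
/-- The cost `1 - ent` of a slope as a function of `C = perspCos p q` and `T = √2 - q`. -/
noncomputable def costFun (C T : ℝ) : ℝ≥0∞ :=
  if T = 0 then 1 else if C = 0 then ⊤ else ENNReal.ofReal (costReal C T)

theorem costFun_eq_ofReal {C T : ℝ} (hC : 0 ≤ C) (h : costFun C T ≠ ⊤) :
    costFun C T = ENNReal.ofReal (costReal C T) ∧ (T = 0 ∨ 0 < C) := by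
  unfold costFun at *
  split_ifs at * with h1 h2
  · simp [h1, costReal]
  · exact absurd rfl h
  · exact ⟨rfl, Or.inr (lt_of_le_of_ne hC (Ne.symm h2))⟩

theorem costLine_le_costFun {v C T : ℝ} (hv : 0 < v) (hC : 0 ≤ C) (hT : 0 ≤ T) :
    ENNReal.ofReal (costLine v C T) ≤ costFun C T := by
  by_cases h : costFun C T = ⊤
  · rw [h]; exact le_top
  · obtain ⟨h1, h2⟩ := costFun_eq_ofReal hC h
    rw [h1]
    exact ENNReal.ofReal_le_ofReal (costLine_le_costReal hv hC hT h2)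

/-- For `T = 0` the supremum is approached as `v → 0`, for `C = 0 < T` as `v → ∞`, and otherwise it
is attained at `v = π T / C`. The degenerate values 1 and `⊤` of `costFun` are thus the ones that
make the cost convex and lower semicontinuous. -/
theorem costFun_eq_iSup {C T : ℝ} (hC : 0 ≤ C) (hT : 0 ≤ T) :
    costFun C T = ⨆ v : {v : ℝ // 0 < v}, ENNReal.ofReal (costLine v C T) := by
  have hp := Real.pi_pos
  refine le_antisymm ?_ (iSup_le fun v => costLine_le_costFun v.2 hC hT)
  rcases hT.eq_or_lt with rfl | hT
  · have h1 : Tendsto (fun v : ℝ => ENNReal.ofReal (costLine v C 0)) (𝓝[>] 0) (𝓝 1) := by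
      have : Tendsto (fun v : ℝ => costLine v C 0) (𝓝[>] 0) (𝓝 1) := by
        have hc : Continuous fun v : ℝ => 1 - v / Real.pi * C := by fun_prop
        have := (hc.tendsto 0).mono_left (nhdsWithin_le_nhds (s := Ioi 0))
        simpa [costLine] using this
      have := (ENNReal.continuous_ofReal.tendsto 1).comp this
      rwa [ENNReal.ofReal_one] at this
    simp only [costFun, if_true]
    refine le_of_tendsto h1 ?_
    filter_upwards [self_mem_nhdsWithin] with v hv
    exact le_iSup (fun v : {v : ℝ // 0 < v} => ENNReal.ofReal (costLine v C 0)) ⟨v, hv⟩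
  · rcases hC.eq_or_lt with rfl | hC
    · have h1 : Tendsto (fun v : ℝ => ENNReal.ofReal (costLine v 0 T)) atTop (𝓝 ⊤) := by
        refine ENNReal.tendsto_ofReal_atTop.comp ?_
        simp only [costLine, mul_zero, sub_zero]
        exact tendsto_atTop_add_const_left _ _ (Real.tendsto_log_atTop.const_mul_atTop hT)
      refine le_of_tendsto' (x := atTop) (f := fun _ : ℝ => costFun 0 T) tendsto_const_nhds
        fun _ => ?_
      refine le_top.trans (le_of_tendsto h1 ?_)
      filter_upwards [eventually_gt_atTop 0] with v hv
      exact le_iSup (fun v : {v : ℝ // 0 < v} => ENNReal.ofReal (costLine v 0 T)) ⟨v, hv⟩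
    · have hv : 0 < Real.pi * T / C := by positivity
      refine le_trans (le_of_eq ?_)
        (le_iSup (fun v : {v : ℝ // 0 < v} => ENNReal.ofReal (costLine v C T)) ⟨_, hv⟩)
      simp only [costFun, hT.ne', hC.ne', if_false, costLine_optimal hC]

theorem costLine_midpoint_le {v C C₁ C₂ T₁ T₂ : ℝ} (hv : 0 < v) (h : (C₁ + C₂) / 2 ≤ C) :
    costLine v C ((T₁ + T₂) / 2) ≤ (costLine v C₁ T₁ + costLine v C₂ T₂) / 2 := by
  have := mul_le_mul_of_nonneg_left h (show 0 ≤ v / Real.pi by have := Real.pi_pos; positivity)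
  simp only [costLine]
  linarith

/-- The cost of a slope `(p, q)`. -/
noncomputable def cost (p q : ℝ) : ℝ≥0∞ := costFun (perspCos p q) (√2 - q)

/-- Each `costLine` is affine in `(C, T)` and nonincreasing in `C`, while `C` is concave and `T`
affine in the slope. -/
theorem cost_midpoint_le {p₁ q₁ p₂ q₂ : ℝ} (h₁ : 2 * √2 * |p₁| ≤ q₁) (h₂ : 2 * √2 * |p₂| ≤ q₂)
    (h₁' : q₁ ≤ √2) (h₂' : q₂ ≤ √2) :
    cost ((p₁ + p₂) / 2) ((q₁ + q₂) / 2) ≤ (cost p₁ q₁ + cost p₂ q₂) / 2 := by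
  have hm := perspCos_midpoint h₁ h₂
  have hC₁ := perspCos_nonneg h₁
  have hC₂ := perspCos_nonneg h₂
  unfold cost
  rw [costFun_eq_iSup (by linarith) (by linarith)]
  refine iSup_le fun v => ?_
  have e : √2 - (q₁ + q₂) / 2 = ((√2 - q₁) + (√2 - q₂)) / 2 := by ring
  rw [e]
  refine (ENNReal.ofReal_le_ofReal (costLine_midpoint_le v.2 hm)).trans ?_
  rw [ENNReal.ofReal_div_of_pos two_pos, ENNReal.ofReal_ofNat]
  refine ENNReal.div_le_div_right ?_ 2
  exact ENNReal.ofReal_add_le.trans (add_le_add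
    (costLine_le_costFun v.2 hC₁ (by linarith)) (costLine_le_costFun v.2 hC₂ (by linarith)))

/-- Compare with the member `v = 1`, which is `1 - C / π`. -/
theorem costReal_nonneg {C T : ℝ} (hC : 0 ≤ C) (hC' : C ≤ √2) (hT : 0 ≤ T) (h : T = 0 ∨ 0 < C) :
    0 ≤ costReal C T := by
  refine le_trans ?_ (costLine_le_costReal one_pos hC hT h)
  have h3 := Real.pi_gt_three
  have : 1 / Real.pi * C ≤ 1 := by
    rw [div_mul_eq_mul_div, div_le_one (by linarith)]
    linarith [sqrt_two_lt_two]
  simp only [costLine, Real.log_one]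
  linarith

/-- If equality held, the `v` optimal at the midpoint would be optimal at both ends, so `v Cᵢ = π
Tᵢ`, and the concavity of `C` would be an equality, so the two angles agree. With a common angle `α`
this reads `v qᵢ cos α = π (√2 - qᵢ)`, which determines `qᵢ`. Strictness in `p` alone fails: on `q =
√2` the cost is constantly 1. -/
theorem cost_midpoint_lt {p₁ q₁ p₂ q₂ : ℝ} (h₁ : 2 * √2 * |p₁| ≤ q₁) (h₂ : 2 * √2 * |p₂| ≤ q₂)
    (h₁' : q₁ ≤ √2) (h₂' : q₂ ≤ √2) (hf₁ : cost p₁ q₁ ≠ ⊤) (hf₂ : cost p₂ q₂ ≠ ⊤)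
    (hne : q₁ ≠ q₂) :
    cost ((p₁ + p₂) / 2) ((q₁ + q₂) / 2) < (cost p₁ q₁ + cost p₂ q₂) / 2 := by
  have hp := Real.pi_pos
  have hm := perspCos_midpoint h₁ h₂
  have hC₁ := perspCos_nonneg h₁
  have hC₂ := perspCos_nonneg h₂
  have hC₁' := perspCos_le (p := p₁) (nonneg_of_cone h₁)
  have hC₂' := perspCos_le (p := p₂) (nonneg_of_cone h₂)
  obtain ⟨e₁, d₁⟩ := costFun_eq_ofReal hC₁ hf₁
  obtain ⟨e₂, d₂⟩ := costFun_eq_ofReal hC₂ hf₂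
  have eT : √2 - (q₁ + q₂) / 2 = ((√2 - q₁) + (√2 - q₂)) / 2 := by ring
  unfold cost
  rw [e₁, e₂, eT]
  have hTm : 0 < ((√2 - q₁) + (√2 - q₂)) / 2 := by
    rcases lt_or_gt_of_ne hne with h | h <;> linarith
  have hCm : 0 < perspCos ((p₁ + p₂) / 2) ((q₁ + q₂) / 2) := by
    refine lt_of_lt_of_le ?_ hm
    rcases d₁ with d₁ | d₁
    · rcases d₂ with d₂ | d₂
      · exact absurd (by linarith) hne
      · linarith
    · linarith
  have n₁ := costReal_nonneg hC₁ (hC₁'.trans h₁') (by linarith) d₁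
  have n₂ := costReal_nonneg hC₂ (hC₂'.trans h₂') (by linarith) d₂
  have hmf : costFun (perspCos ((p₁ + p₂) / 2) ((q₁ + q₂) / 2)) (((√2 - q₁) + (√2 - q₂)) / 2) =
      ENNReal.ofReal (costReal (perspCos ((p₁ + p₂) / 2) ((q₁ + q₂) / 2))
        (((√2 - q₁) + (√2 - q₂)) / 2)) := by
    simp [costFun, hTm.ne', hCm.ne']
  rw [hmf, ← ENNReal.ofReal_add n₁ n₂, ← ENNReal.ofReal_ofNat 2, ← ENNReal.ofReal_div_of_pos two_pos]
  set v := Real.pi * (((√2 - q₁) + (√2 - q₂)) / 2) / perspCos ((p₁ + p₂) / 2) ((q₁ + q₂) / 2) with hv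
  have hv0 : 0 < v := by positivity
  have h0 := costLine_optimal (T := ((√2 - q₁) + (√2 - q₂)) / 2) hCm
  rw [← hv] at h0
  have l₁ := costLine_le_costReal hv0 hC₁ (by linarith) d₁
  have l₂ := costLine_le_costReal hv0 hC₂ (by linarith) d₂
  have lm := costLine_midpoint_le (T₁ := √2 - q₁) (T₂ := √2 - q₂) hv0 hm
  have hmn : costReal (perspCos ((p₁ + p₂) / 2) ((q₁ + q₂) / 2)) (((√2 - q₁) + (√2 - q₂)) / 2) <
      (costReal (perspCos p₁ q₁) (√2 - q₁) + costReal (perspCos p₂ q₂) (√2 - q₂)) / 2 := by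
    by_contra hcon
    rw [not_lt, ← h0] at hcon
    have k₁ := mul_eq_of_costLine_eq hv0 (by linarith) d₁ (by linarith)
    have k₂ := mul_eq_of_costLine_eq hv0 (by linarith) d₂ (by linarith)
    have keq : perspCos p₁ q₁ + perspCos p₂ q₂ = perspCos (p₁ + p₂) (q₁ + q₂) := by
      have h5 : costLine v (perspCos ((p₁ + p₂) / 2) ((q₁ + q₂) / 2)) (((√2 - q₁) + (√2 - q₂)) / 2)
        = (costLine v (perspCos p₁ q₁) (√2 - q₁) + costLine v (perspCos p₂ q₂) (√2 - q₂)) / 2 := by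
        linarith
      rw [perspCos_half] at h5
      simp only [costLine] at h5
      have h6 : v / Real.pi * (perspCos p₁ q₁ + perspCos p₂ q₂) =
        v / Real.pi * perspCos (p₁ + p₂) (q₁ + q₂) := by linarith
      exact mul_left_cancel₀ (by positivity) h6
    have hq₁ : 0 < q₁ := by
      refine lt_of_le_of_ne (nonneg_of_cone h₁) fun h => ?_
      subst h
      simp only [perspCos, zero_mul, mul_zero, sub_zero] at k₁
      have := sqrt_two_pos
      have : 0 < Real.pi * √2 := by positivity
      linarith
    have hq₂ : 0 < q₂ := by
      refine lt_of_le_of_ne (nonneg_of_cone h₂) fun h => ?_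
      subst h
      simp only [perspCos, zero_mul, mul_zero, sub_zero] at k₂
      have := sqrt_two_pos
      have : 0 < Real.pi * √2 := by positivity
      linarith
    have hang : √2 * Real.pi * p₁ / q₁ = √2 * Real.pi * p₂ / q₂ := by
      by_contra hne'
      exact (perspCos_add_lt h₁ h₂ hq₁ hq₂ hne').ne keq
    have hcos := Real.cos_nonneg_of_mem_Icc (angle_mem_Icc hq₂ h₂)
    simp only [perspCos, hang] at k₁ k₂
    have : (q₁ - q₂) * (v * Real.cos (√2 * Real.pi * p₂ / q₂) + Real.pi) = 0 := by linarith
    rcases mul_eq_zero.1 this with h | h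
    · exact hne (by linarith)
    · have : 0 ≤ v * Real.cos (√2 * Real.pi * p₂ / q₂) := by positivity
      linarith
  exact (ENNReal.ofReal_lt_ofReal_iff_of_nonneg (by
    exact costReal_nonneg hCm.le (by
      refine (perspCos_le (by linarith [nonneg_of_cone h₁, nonneg_of_cone h₂])).trans ?_
      linarith) hTm.le (Or.inr hCm))).2 hmn

theorem tendsto_perspCos {ι : Type*} {l : Filter ι} {u v : ι → ℝ} {p q : ℝ}
    (hu : Tendsto u l (𝓝 p)) (hv : Tendsto v l (𝓝 q)) (h : 2 * √2 * |p| ≤ q) :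
    Tendsto (fun i => perspCos (u i) (v i)) l (𝓝 (perspCos p q)) := by
  rcases (nonneg_of_cone h).eq_or_lt with hq | hq
  · subst hq
    have h0 : perspCos p 0 = 0 := by simp [perspCos]
    rw [h0]
    refine squeeze_zero_norm (a := fun i => |v i|) (fun i => ?_) (by simpa using hv.abs)
    rw [perspCos, Real.norm_eq_abs, abs_mul]
    exact mul_le_of_le_one_right (abs_nonneg _) (Real.abs_cos_le_one _)
  · exact hv.mul ((Real.continuous_cos.tendsto _).comp ((hu.const_mul _).div hv hq.ne'))

/-- A supremum of functions continuous on the cone is lower semicontinuous there. -/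
theorem cost_le_liminf {ι : Type*} {l : Filter ι} [l.NeBot] {u v : ι → ℝ} {p q : ℝ}
    (hu : Tendsto u l (𝓝 p)) (hv : Tendsto v l (𝓝 q))
    (huv : ∀ i, 2 * √2 * |u i| ≤ v i) (hv' : ∀ i, v i ≤ √2) :
    cost p q ≤ liminf (fun i => cost (u i) (v i)) l := by
  have h : 2 * √2 * |p| ≤ q := le_of_tendsto_of_tendsto' (hu.abs.const_mul _) hv huv
  have h' : q ≤ √2 := le_of_tendsto' hv hv'
  unfold cost
  rw [costFun_eq_iSup (perspCos_nonneg h) (by linarith)]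
  refine iSup_le fun w => ?_
  have ht : Tendsto (fun i => ENNReal.ofReal (costLine w (perspCos (u i) (v i)) (√2 - v i))) l
      (𝓝 (ENNReal.ofReal (costLine w (perspCos p q) (√2 - q)))) := by
    refine (ENNReal.continuous_ofReal.tendsto _).comp ?_
    exact (tendsto_const_nhds.sub ((tendsto_perspCos hu hv h).const_mul _)).add
      ((tendsto_const_nhds.sub hv).mul_const _)
  rw [← ht.liminf_eq]
  exact liminf_le_liminf (Eventually.of_forall fun i =>
    costLine_le_costFun w.2 (perspCos_nonneg (huv i)) (by linarith [hv' i]))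

theorem measurable_cost : Measurable fun z : ℝ × ℝ => cost z.1 z.2 := by
  have h1 : Measurable fun z : ℝ × ℝ => perspCos z.1 z.2 := by unfold perspCos; fun_prop
  have h2 : Measurable fun z : ℝ × ℝ => √2 - z.2 := by fun_prop
  unfold cost costFun
  refine Measurable.ite (h2 (measurableSet_singleton 0)) measurable_const
    (Measurable.ite (h1 (measurableSet_singleton 0)) measurable_const ?_)
  unfold costReal
  refine ENNReal.measurable_ofReal.comp ?_
  exact measurable_const.sub (h2.mul (measurable_const.add (Real.measurable_log.comp
    (h1.div (measurable_const.mul h2)))))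

theorem cost_zero_right {p : ℝ} : cost p 0 = ⊤ := by
  simp [cost, costFun, perspCos, sqrt_two_pos.ne']

/-! ### The cost and the rotated local entropy -/

theorem one_sub_add_toENNReal {r : ℝ} (h : r ≤ 1) :
    ENNReal.ofReal (1 - r) + (r : EReal).toENNReal = 1 + (-(r : EReal)).toENNReal ∧
      (r : EReal).toENNReal ≤ 1 := by
  rw [← EReal.coe_neg, EReal.toENNReal_of_ne_top (EReal.coe_ne_top r),
    EReal.toENNReal_of_ne_top (EReal.coe_ne_top (-r)), EReal.toReal_coe, EReal.toReal_coe]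
  constructor
  · rcases le_total 0 r with h0 | h0
    · rw [ENNReal.ofReal_of_nonpos (by linarith : -r ≤ 0), add_zero,
        ← ENNReal.ofReal_add (by linarith) h0]
      simp
    · rw [ENNReal.ofReal_of_nonpos h0, add_zero, ← ENNReal.ofReal_one,
        ← ENNReal.ofReal_add (by linarith) (by linarith)]
      ring_nf
  · exact ENNReal.ofReal_le_one.2 h

/-- On the admissible slopes, `cost` is `1 - turnedEnt`. -/
theorem cost_add_turnedEnt {p q : ℝ} (h : 2 * √2 * |p| ≤ q) (h' : q ≤ √2) :
    cost p q + (turnedEnt (-(√2 * p)) (1 - √2 * q)).toENNReal =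
      1 + (-turnedEnt (-(√2 * p)) (1 - √2 * q)).toENNReal ∧
      (turnedEnt (-(√2 * p)) (1 - √2 * q)).toENNReal ≤ 1 := by
  have hp := Real.pi_pos
  have hs := sqrt_two_pos
  have h22 := sqrt_two_mul_self
  rcases (nonneg_of_cone h).eq_or_lt with hq | hq
  · subst hq
    simp [turnedEnt, cost_zero_right]
  -- The rotated slope `(s, t)` is `(-√2 p, 1 - √2 q)`: the Jacobian becomes `q`, and the arguments
  -- of `ent` become `-√2 p / q` and `(√2 - q) / q`.
  have ht : 1 - √2 * q ≠ 1 := by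
    have : 0 < √2 * q := by positivity
    linarith
  have e0 : √2 / 2 * (1 - (1 - √2 * q)) = q := by linear_combination q / 2 * h22
  have e1 : √2 * -(√2 * p) / (1 - (1 - √2 * q)) = -(√2 * p / q) := by
    field_simp
    ring
  have e2 : (1 + (1 - √2 * q)) / (1 - (1 - √2 * q)) = (√2 - q) / q := by
    field_simp
    linear_combination (-q) * h22
  have habs : |-(√2 * p / q)| = √2 * |p| / q := by
    rw [abs_neg, abs_div, abs_mul, abs_of_pos hs, abs_of_pos hq]
  have hle : √2 * |p| / q ≤ 1 / 2 := by
    rw [div_le_div_iff₀ hq two_pos]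
    linarith
  have hT0 : 0 ≤ (√2 - q) / q := div_nonneg (by linarith) hq.le
  have hcos : Real.cos (Real.pi * -(√2 * p / q)) = Real.cos (√2 * Real.pi * p / q) := by
    rw [← Real.cos_neg]
    congr 1
    ring
  have hC : perspCos p q = q * Real.cos (Real.pi * -(√2 * p / q)) := by rw [perspCos, hcos]
  rw [turnedEnt, if_neg ht, e0, e1, e2, ent, if_neg (by rw [habs]; push Not; exact ⟨hT0, hle⟩)]
  by_cases hT : √2 - q = 0
  · rw [if_pos (by rw [hT, zero_div])]
    simp [cost, costFun, hT]
  have hTp : 0 < √2 - q := lt_of_le_of_ne (by linarith) (Ne.symm hT)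
  rw [if_neg (by positivity)]
  by_cases hhalf : |-(√2 * p / q)| = 1 / 2
  · have hC0 : perspCos p q = 0 := by
      have : |Real.pi * -(√2 * p / q)| = Real.pi / 2 := by
        rw [abs_mul, hhalf, abs_of_pos hp]; ring
      rw [hC, ← Real.cos_abs, this, Real.cos_pi_div_two, mul_zero]
    rw [if_pos hhalf, EReal.coe_mul_bot_of_pos hq]
    simp [cost, costFun, hT, hC0]
  · have hcp : 0 < Real.cos (Real.pi * -(√2 * p / q)) := by
      rw [← Real.cos_abs, abs_mul, abs_of_pos hp]
      have h1 : |-(√2 * p / q)| < 1 / 2 := lt_of_le_of_ne (habs ▸ hle) hhalf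
      have h2 : 0 ≤ |-(√2 * p / q)| := abs_nonneg _
      exact Real.cos_pos_of_mem_Ioo ⟨by nlinarith, by nlinarith⟩
    have hCp : 0 < perspCos p q := by rw [hC]; positivity
    rw [if_neg hhalf, ← EReal.coe_mul]
    have e3 : q * ((1 + Real.log (Real.cos (Real.pi * -(√2 * p / q)) /
        (Real.pi * ((√2 - q) / q)))) * ((√2 - q) / q)) =
        1 - costReal (perspCos p q) (√2 - q) := by
      have e4 : Real.cos (Real.pi * -(√2 * p / q)) / (Real.pi * ((√2 - q) / q)) =
          perspCos p q / (Real.pi * (√2 - q)) := by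
        rw [hC]; field_simp
      rw [e4, costReal]
      field_simp
      ring
    have e5 : cost p q = ENNReal.ofReal (1 - (1 - costReal (perspCos p q) (√2 - q))) := by
      simp [cost, costFun, hT, hCp.ne']
    rw [e3, e5]
    refine one_sub_add_toENNReal ?_
    linarith [costReal_nonneg hCp.le ((perspCos_le hq.le).trans h') hTp.le (Or.inr hCp)]

/-! ### Profiles and their slopes -/

/-- The `y`-coordinate of the points of a surface as a function on the turned plane. -/
structure IsProfile (b t : ℝ → ℝ) (Y : ℝ × ℝ → ℝ) : Prop where
  bot : ∀ x w, √2 * w ≤ b x → Y (x, w) = 0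
  top : ∀ x w, 1 + t x ≤ √2 * w → Y (x, w) = 1
  cone : ∀ x x' w w', |x - x'| ≤ 2 * √2 * (w' - w) → Y (x, w) ≤ Y (x', w')
  lip : ∀ x w w', w ≤ w' → Y (x, w') - Y (x, w) ≤ √2 * (w' - w)

theorem IsProfile.mono {b t : ℝ → ℝ} {Y : ℝ × ℝ → ℝ} (h : IsProfile b t Y) {x w w' : ℝ}
    (hw : w ≤ w') : Y (x, w) ≤ Y (x, w') :=
  h.cone x x w w' (by
    rw [sub_self, abs_zero]
    have := sqrt_two_pos
    exact mul_nonneg (by positivity) (by linarith))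

theorem IsProfile.nonneg {b t : ℝ → ℝ} {Y : ℝ × ℝ → ℝ} (h : IsProfile b t Y) (z : ℝ × ℝ) :
    0 ≤ Y z := by
  have hs := sqrt_two_pos
  have h0 := h.bot z.1 (min z.2 (b z.1 / √2)) (by
    calc √2 * min z.2 (b z.1 / √2) ≤ √2 * (b z.1 / √2) :=
          mul_le_mul_of_nonneg_left (min_le_right _ _) hs.le
      _ = b z.1 := by field_simp)
  rw [← h0]
  exact h.mono (min_le_left _ _)

theorem IsProfile.le_one {b t : ℝ → ℝ} {Y : ℝ × ℝ → ℝ} (h : IsProfile b t Y) (z : ℝ × ℝ) :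
    Y z ≤ 1 := by
  have hs := sqrt_two_pos
  have h0 := h.top z.1 (max z.2 ((1 + t z.1) / √2)) (by
    calc 1 + t z.1 = √2 * ((1 + t z.1) / √2) := by field_simp
      _ ≤ _ := mul_le_mul_of_nonneg_left (le_max_right _ _) hs.le)
  rw [← h0]
  exact h.mono (le_max_left _ _)

/-- Raising `w` by `δ` brings `(x', w')` below `(x, w + δ)` in the cone order; the vertical
Lipschitz bound then controls the remaining increment. -/
theorem IsProfile.sub_le {b t : ℝ → ℝ} {Y : ℝ × ℝ → ℝ} (h : IsProfile b t Y) (x w x' w' : ℝ) :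
    Y (x', w') - Y (x, w) ≤ √2 * |w' - w| + |x' - x| / 2 := by
  have hs := sqrt_two_pos
  set δ := |w' - w| + |x' - x| / (2 * √2) with hδ
  have hd : 0 ≤ |x' - x| / (2 * √2) := by positivity
  have h1 : Y (x', w') ≤ Y (x, w + δ) := h.cone _ _ _ _ (by
    have e : |x' - x| = 2 * √2 * (|x' - x| / (2 * √2)) := by field_simp
    rw [e]
    refine mul_le_mul_of_nonneg_left ?_ (by positivity)
    have := le_abs_self (w' - w)
    linarith)
  have h2 := h.lip x w (w + δ) (by have := abs_nonneg (w' - w); linarith)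
  have h3 : √2 * (w + δ - w) = √2 * |w' - w| + |x' - x| / 2 := by
    rw [hδ]; field_simp; ring
  linarith

theorem IsProfile.lipschitz {b t : ℝ → ℝ} {Y : ℝ × ℝ → ℝ} (h : IsProfile b t Y) :
    LipschitzWith 3 Y := by
  refine LipschitzWith.of_le_add_mul 3 fun z z' => ?_
  have h1 := h.sub_le z'.1 z'.2 z.1 z.2
  have h2 : |z.1 - z'.1| ≤ dist z z' := le_max_left _ _
  have h3 : |z.2 - z'.2| ≤ dist z z' := le_max_right _ _
  have h4 := sqrt_two_lt_two
  have h5 := sqrt_two_pos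
  have h6 := abs_nonneg (z.2 - z'.2)
  have h7 := abs_nonneg (z.1 - z'.1)
  change Y z ≤ Y z' + 3 * dist z z'
  simp only [Prod.mk.eta] at h1
  nlinarith

theorem IsProfile.midpoint {b t : ℝ → ℝ} {Y Z : ℝ × ℝ → ℝ} (h : IsProfile b t Y)
    (h' : IsProfile b t Z) : IsProfile b t fun z => (Y z + Z z) / 2 where
  bot x w hw := by simp [h.bot x w hw, h'.bot x w hw]
  top x w hw := by simp [h.top x w hw, h'.top x w hw]
  cone x x' w w' hw := by linarith [h.cone x x' w w' hw, h'.cone x x' w w' hw]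
  lip x w w' hw := by linarith [h.lip x w w' hw, h'.lip x w w' hw]

theorem IsProfile.of_tendsto {ι : Type*} {l : Filter ι} [l.NeBot] {b t : ℝ → ℝ}
    {Z : ι → ℝ × ℝ → ℝ} {Y : ℝ × ℝ → ℝ} (h : ∀ i, IsProfile b t (Z i))
    (hl : ∀ z, Tendsto (fun i => Z i z) l (𝓝 (Y z))) : IsProfile b t Y where
  bot x w hw := tendsto_nhds_unique (hl _)
    (tendsto_const_nhds.congr fun i => ((h i).bot x w hw).symm)
  top x w hw := tendsto_nhds_unique (hl _)
    (tendsto_const_nhds.congr fun i => ((h i).top x w hw).symm)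
  cone x x' w w' hw := le_of_tendsto_of_tendsto' (hl _) (hl _) fun i => (h i).cone x x' w w' hw
  lip x w w' hw := le_of_tendsto' ((hl _).sub (hl _)) fun i => (h i).lip x w w' hw

/-- The partial derivatives of a function on the plane. -/
noncomputable def gradX (Y : ℝ × ℝ → ℝ) (z : ℝ × ℝ) : ℝ := deriv (fun x => Y (x, z.2)) z.1

noncomputable def gradY (Y : ℝ × ℝ → ℝ) (z : ℝ × ℝ) : ℝ := deriv (fun w => Y (z.1, w)) z.2

theorem hasDerivAt_gradX {Y : ℝ × ℝ → ℝ} {z : ℝ × ℝ} (h : DifferentiableAt ℝ Y z) :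
    HasDerivAt (fun x => Y (x, z.2)) (gradX Y z) z.1 := by
  refine DifferentiableAt.hasDerivAt ?_
  have h1 : DifferentiableAt ℝ (fun x : ℝ => (x, z.2)) z.1 := by fun_prop
  exact DifferentiableAt.comp z.1 (g := Y) h h1

theorem hasDerivAt_gradY {Y : ℝ × ℝ → ℝ} {z : ℝ × ℝ} (h : DifferentiableAt ℝ Y z) :
    HasDerivAt (fun w => Y (z.1, w)) (gradY Y z) z.2 := by
  refine DifferentiableAt.hasDerivAt ?_
  have h1 : DifferentiableAt ℝ (fun w : ℝ => (z.1, w)) z.2 := by fun_prop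
  exact DifferentiableAt.comp z.2 (g := Y) h h1

theorem nonneg_of_hasDerivAt {f : ℝ → ℝ} {f' : ℝ} (h : HasDerivAt f f' 0) (h0 : f 0 = 0)
    (hf : ∀ ε, 0 < ε → 0 ≤ f ε) : 0 ≤ f' := by
  have h1 := h.tendsto_slope.mono_left (nhdsWithin_mono 0 (fun x (hx : x ∈ Ioi (0 : ℝ)) => ne_of_gt hx))
  refine ge_of_tendsto h1 ?_
  filter_upwards [self_mem_nhdsWithin] with x hx
  have hx : 0 < x := hx
  rw [slope_def_field, h0, sub_zero, sub_zero]
  exact div_nonneg (hf x hx) hx.le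

/-- The infinitesimal form of `cone` and `lip`: a step `ε` in `x` is compared with steps `± ε /
(2√2)` in `w`, the edge of the cone. -/
theorem IsProfile.slope_mem {b t : ℝ → ℝ} {Y : ℝ × ℝ → ℝ} (h : IsProfile b t Y) {z : ℝ × ℝ}
    (hz : DifferentiableAt ℝ Y z) :
    2 * √2 * |gradX Y z| ≤ gradY Y z ∧ gradY Y z ≤ √2 := by
  have hs := sqrt_two_pos
  have hx : HasDerivAt (fun ε => Y (z.1 + ε, z.2)) (gradX Y z) 0 := by
    have := hasDerivAt_gradX hz
    rw [← add_zero z.1] at this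
    exact this.comp_const_add z.1 0
  have hw : HasDerivAt (fun ε => Y (z.1, z.2 + ε)) (gradY Y z) 0 := by
    have := hasDerivAt_gradY hz
    rw [← add_zero z.2] at this
    exact this.comp_const_add z.2 0
  have hc : ∀ c : ℝ, HasDerivAt (fun ε => Y (z.1, z.2 + c * ε)) (gradY Y z * c) 0 := by
    intro c
    have h1 : HasDerivAt (fun ε : ℝ => c * ε) c 0 := by
      simpa using (hasDerivAt_id (0 : ℝ)).const_mul c
    have h2 : HasDerivAt (fun ε => Y (z.1, z.2 + ε)) (gradY Y z) (c * 0) := by rwa [mul_zero]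
    exact HasDerivAt.comp (0 : ℝ) (h₂ := fun ε => Y (z.1, z.2 + ε)) (h := fun ε => c * ε) h2 h1
  have key : ∀ ε : ℝ, 0 < ε → |ε| ≤ 2 * √2 * (1 / (2 * √2) * ε) := fun ε hε => by
    rw [abs_of_pos hε]
    exact le_of_eq (by field_simp)
  have h1 : 0 ≤ gradY Y z * (1 / (2 * √2)) - gradX Y z := by
    refine nonneg_of_hasDerivAt ((hc (1 / (2 * √2))).sub hx) (by simp) fun ε hε => ?_
    refine sub_nonneg.2 (h.cone _ _ _ _ ?_)
    rw [add_sub_cancel_left, add_sub_cancel_left]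
    exact key ε hε
  have h2 : 0 ≤ gradX Y z - gradY Y z * (-(1 / (2 * √2))) := by
    refine nonneg_of_hasDerivAt (hx.sub (hc (-(1 / (2 * √2))))) (by simp) fun ε hε => ?_
    refine sub_nonneg.2 (h.cone _ _ _ _ ?_)
    have := key ε hε
    rw [show z.1 - (z.1 + ε) = -ε by ring, abs_neg]
    refine this.trans (le_of_eq (by ring))
  have h3 : 0 ≤ √2 - gradY Y z := by
    have h4 : HasDerivAt (fun ε : ℝ => √2 * ε) √2 0 := by
      simpa using (hasDerivAt_id (0 : ℝ)).const_mul √2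
    refine nonneg_of_hasDerivAt (f := fun ε => √2 * ε - (Y (z.1, z.2 + ε) - Y z))
      (h4.sub (hw.sub_const _)) (by simp) fun ε hε => ?_
    have := h.lip z.1 z.2 (z.2 + ε) (by linarith)
    rw [add_sub_cancel_left] at this
    exact sub_nonneg.2 this
  refine ⟨?_, by linarith⟩
  have h5 : |gradX Y z| ≤ gradY Y z * (1 / (2 * √2)) := abs_le.2 ⟨by linarith, by linarith⟩
  calc 2 * √2 * |gradX Y z| ≤ 2 * √2 * (gradY Y z * (1 / (2 * √2))) :=
        mul_le_mul_of_nonneg_left h5 (by positivity)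
    _ = gradY Y z := by field_simp

theorem IsProfile.ae_differentiableAt {b t : ℝ → ℝ} {Y : ℝ × ℝ → ℝ} (h : IsProfile b t Y) :
    ∀ᵐ z : ℝ × ℝ, DifferentiableAt ℝ Y z :=
  h.lipschitz.ae_differentiableAt

theorem IsProfile.ae_slope_mem {b t : ℝ → ℝ} {Y : ℝ × ℝ → ℝ} (h : IsProfile b t Y) :
    ∀ᵐ z : ℝ × ℝ, 2 * √2 * |gradX Y z| ≤ gradY Y z ∧ gradY Y z ≤ √2 :=
  h.ae_differentiableAt.mono fun _ hz => h.slope_mem hz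

theorem gradX_midpoint {Y Z : ℝ × ℝ → ℝ} {z : ℝ × ℝ} (hY : DifferentiableAt ℝ Y z)
    (hZ : DifferentiableAt ℝ Z z) :
    gradX (fun z => (Y z + Z z) / 2) z = (gradX Y z + gradX Z z) / 2 :=
  (((hasDerivAt_gradX hY).add (hasDerivAt_gradX hZ)).div_const 2).deriv

theorem gradY_midpoint {Y Z : ℝ × ℝ → ℝ} {z : ℝ × ℝ} (hY : DifferentiableAt ℝ Y z)
    (hZ : DifferentiableAt ℝ Z z) :
    gradY (fun z => (Y z + Z z) / 2) z = (gradY Y z + gradY Z z) / 2 :=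
  (((hasDerivAt_gradY hY).add (hasDerivAt_gradY hZ)).div_const 2).deriv

theorem measurable_gradX {Y : ℝ × ℝ → ℝ} (h : Continuous Y) : Measurable (gradX Y) := by
  have h1 : Continuous (Function.uncurry fun w x : ℝ => Y (x, w)) := by
    exact h.comp continuous_swap
  exact (measurable_deriv_with_param h1).comp measurable_swap

theorem measurable_gradY {Y : ℝ × ℝ → ℝ} (h : Continuous Y) : Measurable (gradY Y) := by
  have h1 : Continuous (Function.uncurry fun x w : ℝ => Y (x, w)) := h
  exact measurable_deriv_with_param h1

/-! ### The total cost and its convexity -/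

/-- The region between the two boundary curves. -/
def strip (b t : ℝ → ℝ) : Set (ℝ × ℝ) :=
  {z | z.1 ∈ Icc (0 : ℝ) 1 ∧ b z.1 ≤ √2 * z.2 ∧ √2 * z.2 ≤ 1 + t z.1}

noncomputable def totalCost (b t : ℝ → ℝ) (Y : ℝ × ℝ → ℝ) : ℝ≥0∞ :=
  ∫⁻ z in strip b t, cost (gradX Y z) (gradY Y z)

theorem measurable_cost_grad {Y : ℝ × ℝ → ℝ} (h : Continuous Y) :
    Measurable fun z => cost (gradX Y z) (gradY Y z) :=
  measurable_cost.comp ((measurable_gradX h).prodMk (measurable_gradY h))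

theorem totalCost_midpoint_le {b t : ℝ → ℝ} {Y Z : ℝ × ℝ → ℝ} (hY : IsProfile b t Y)
    (hZ : IsProfile b t Z) :
    totalCost b t (fun z => (Y z + Z z) / 2) ≤ (totalCost b t Y + totalCost b t Z) / 2 := by
  unfold totalCost
  rw [← lintegral_add_left (measurable_cost_grad hY.lipschitz.continuous), div_eq_mul_inv,
    ← lintegral_mul_const' _ _ (by simp)]
  refine lintegral_mono_ae (ae_restrict_of_ae ?_)
  filter_upwards [hY.ae_differentiableAt, hZ.ae_differentiableAt] with z h1 h2
  rw [gradX_midpoint h1 h2, gradY_midpoint h1 h2, ← div_eq_mul_inv]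
  obtain ⟨a1, a2⟩ := hY.slope_mem h1
  obtain ⟨c1, c2⟩ := hZ.slope_mem h2
  exact cost_midpoint_le a1 c1 a2 c2

/-- The pointwise midpoint inequality integrates to an equality of finite quantities, so it is an
equality almost everywhere. Where both costs are finite, strict convexity leaves only equal `q`. -/
theorem gradY_ae_eq_of_minimal {b t : ℝ → ℝ} {Y Z : ℝ × ℝ → ℝ} (hY : IsProfile b t Y)
    (hZ : IsProfile b t Z) (hfY : totalCost b t Y ≠ ⊤) (hfZ : totalCost b t Z ≠ ⊤)
    (hle : (totalCost b t Y + totalCost b t Z) / 2 ≤ totalCost b t (fun z => (Y z + Z z) / 2)) :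
    ∀ᵐ z ∂(volume.restrict (strip b t)), gradY Y z = gradY Z z := by
  have mY := measurable_cost_grad hY.lipschitz.continuous
  have mZ := measurable_cost_grad hZ.lipschitz.continuous
  have hdY := ae_restrict_of_ae (s := strip b t) hY.ae_differentiableAt
  have hdZ := ae_restrict_of_ae (s := strip b t) hZ.ae_differentiableAt
  have hfin := ne_top_of_le_ne_top (ENNReal.div_ne_top (ENNReal.add_ne_top.2 ⟨hfY, hfZ⟩)
    two_ne_zero) (totalCost_midpoint_le hY hZ)
  unfold totalCost at hle hfY hfZ hfin
  rw [← lintegral_add_left mY, div_eq_mul_inv, ← lintegral_mul_const' _ _ (by simp)] at hle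
  have hae := ae_eq_of_ae_le_of_lintegral_le (μ := volume.restrict (strip b t))
    (f := fun z => cost (gradX (fun z => (Y z + Z z) / 2) z) (gradY (fun z => (Y z + Z z) / 2) z))
    (g := fun z => (cost (gradX Y z) (gradY Y z) + cost (gradX Z z) (gradY Z z)) * 2⁻¹)
    (by
      filter_upwards [hdY, hdZ] with z h1 h2
      rw [gradX_midpoint h1 h2, gradY_midpoint h1 h2, ← div_eq_mul_inv]
      obtain ⟨a1, a2⟩ := hY.slope_mem h1
      obtain ⟨c1, c2⟩ := hZ.slope_mem h2
      exact cost_midpoint_le a1 c1 a2 c2) hfin ((mY.add mZ).mul_const _).aemeasurable hle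
  filter_upwards [hae, hdY, hdZ, ae_lt_top mY hfY, ae_lt_top mZ hfZ] with z h0 h1 h2 h3 h4
  by_contra hne
  rw [gradX_midpoint h1 h2, gradY_midpoint h1 h2, ← div_eq_mul_inv] at h0
  obtain ⟨a1, a2⟩ := hY.slope_mem h1
  obtain ⟨c1, c2⟩ := hZ.slope_mem h2
  exact (cost_midpoint_lt a1 c1 a2 c2 h3.ne h4.ne hne).ne h0

/-! ### Limits of derivatives of equi-Lipschitz functions -/

theorem integral_deriv_of_lipschitz {C : ℝ≥0} {f : ℝ → ℝ} (hf : LipschitzWith C f) (a b : ℝ) :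
    ∫ x in a..b, deriv f x = f b - f a :=
  (hf.lipschitzOnWith (s := uIcc a b)).absolutelyContinuousOnInterval.integral_deriv_eq_sub

/-- If equi-Lipschitz functions converge pointwise and their derivatives converge almost
everywhere, then the limit of the derivatives is the derivative of the limit. -/
theorem ae_deriv_eq_of_tendsto {C : ℝ≥0} {f : ℕ → ℝ → ℝ} {F g : ℝ → ℝ} {U : Filter ℕ} [U.NeBot]
    {a b : ℝ} (hab : a ≤ b) (hU : U ≤ atTop) (hf : ∀ n, LipschitzWith C (f n))
    (hF : ∀ x, Tendsto (fun n => f n x) U (𝓝 (F x)))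
    (hg : ∀ᵐ x, x ∈ Ioo a b → Tendsto (fun n => deriv (f n) x) atTop (𝓝 (g x))) :
    ∀ᵐ x, x ∈ Ioo a b → deriv F x = g x := by
  have hne : ∀ᵐ x : ℝ, x ≠ b := by simp [ae_iff, measure_singleton]
  have hg' : ∀ᵐ x, x ∈ Ι a b → Tendsto (fun n => deriv (f n) x) atTop (𝓝 (g x)) := by
    filter_upwards [hg, hne] with x h1 h2 h3
    rw [uIoc_of_le hab] at h3
    exact h1 ⟨h3.1, lt_of_le_of_ne h3.2 h2⟩
  have hmeas : ∀ n s, AEStronglyMeasurable (deriv (f n)) (volume.restrict s) := fun n s =>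
    (measurable_deriv (f n)).aestronglyMeasurable
  have hgm : AEStronglyMeasurable g (volume.restrict (Ι a b)) :=
    aestronglyMeasurable_of_tendsto_ae atTop (fun n => hmeas n _)
      ((ae_restrict_iff' measurableSet_uIoc).2 hg')
  have hgb : ∀ᵐ x ∂(volume.restrict (Ι a b)), ‖g x‖ ≤ C := by
    refine (ae_restrict_iff' measurableSet_uIoc).2 (hg'.mono fun x hx hx' => ?_)
    exact le_of_tendsto' (hx hx').norm fun n => norm_deriv_le_of_lipschitz (hf n)
  have hgi : IntervalIntegrable g volume a b := by
    rw [intervalIntegrable_iff]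
    have : IsFiniteMeasure (volume.restrict (Ι a b)) :=
      isFiniteMeasure_restrict.2 (by simp [uIoc_of_le hab])
    exact Integrable.of_bound hgm C hgb
  -- Dominated convergence passes to the limit in the fundamental theorem of calculus; Lebesgue
  -- differentiation then gives `F' = g`. The derivatives converge along `atTop`, the functions only
  -- along the finer filter `U`.
  have hprim : ∀ x ∈ Icc a b, F x = F a + ∫ u in a..x, g u := by
    intro x hx
    have hsub : Ι a x ⊆ Ι a b := by
      rw [uIoc_of_le hx.1, uIoc_of_le hab]
      exact Ioc_subset_Ioc_right hx.2
    have h1 : Tendsto (fun n => ∫ u in a..x, deriv (f n) u) atTop (𝓝 (∫ u in a..x, g u)) := by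
      refine intervalIntegral.tendsto_integral_filter_of_dominated_convergence (fun _ => (C : ℝ))
        (Eventually.of_forall fun n => hmeas n _)
        (Eventually.of_forall fun n => Eventually.of_forall fun u _ =>
          norm_deriv_le_of_lipschitz (hf n)) intervalIntegrable_const ?_
      filter_upwards [hg'] with u hu hu'
      exact hu (hsub hu')
    simp only [fun n => integral_deriv_of_lipschitz (hf n) a x] at h1
    have h2 := tendsto_nhds_unique (h1.mono_left hU) ((hF x).sub (hF a))
    linarith
  filter_upwards [hgi.ae_hasDerivAt_integral] with x hx hx'
  rw [uIcc_of_le hab] at hx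
  have h1 := (hx (Ioo_subset_Icc_self hx') a (left_mem_Icc.2 hab)).const_add (F a)
  refine (h1.congr_of_eventuallyEq ?_).deriv
  filter_upwards [Icc_mem_nhds hx'.1 hx'.2] with y hy
  exact hprim y hy

theorem lipschitz_section_left {C : ℝ≥0} {Y : ℝ × ℝ → ℝ} (h : LipschitzWith C Y) (w : ℝ) :
    LipschitzWith C fun x => Y (x, w) := by
  simpa [Function.comp_def] using h.comp (LipschitzWith.prodMk_right w)

theorem lipschitz_section_right {C : ℝ≥0} {Y : ℝ × ℝ → ℝ} (h : LipschitzWith C Y) (x : ℝ) :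
    LipschitzWith C fun w => Y (x, w) := by
  simpa [Function.comp_def] using h.comp (LipschitzWith.prodMk_left x)

theorem ae_gradY_eq_of_tendsto {C : ℝ≥0} {Z : ℕ → ℝ × ℝ → ℝ} {Y g : ℝ × ℝ → ℝ} {U : Filter ℕ}
    [U.NeBot] {a b c d : ℝ} (hcd : c ≤ d) (hU : U ≤ atTop) (hZ : ∀ n, LipschitzWith C (Z n))
    (hY : Continuous Y) (hlim : ∀ z, Tendsto (fun n => Z n z) U (𝓝 (Y z))) (hg : Measurable g)
    (h : ∀ᵐ z, z ∈ Ioo a b ×ˢ Ioo c d → Tendsto (fun n => gradY (Z n) z) atTop (𝓝 (g z))) :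
    ∀ᵐ z, z ∈ Ioo a b ×ˢ Ioo c d → gradY Y z = g z := by
  have hm : MeasurableSet {z | z ∈ Ioo a b ×ˢ Ioo c d → gradY Y z = g z} :=
    (measurableSet_Ioo.prod measurableSet_Ioo).imp
      (measurableSet_eq_fun (measurable_gradY hY) hg)
  rw [Measure.volume_eq_prod] at h ⊢
  refine (Measure.ae_prod_iff_ae_ae hm).2 ?_
  filter_upwards [Measure.ae_ae_of_ae_prod h] with x hx
  by_cases hxm : x ∈ Ioo a b
  · have := ae_deriv_eq_of_tendsto (f := fun n w => Z n (x, w)) (F := fun w => Y (x, w))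
      (g := fun w => g (x, w)) hcd hU (fun n => lipschitz_section_right (hZ n) x)
      (fun w => hlim (x, w)) (hx.mono fun w hw hw' => hw ⟨hxm, hw'⟩)
    exact this.mono fun w hw hw' => hw hw'.2
  · exact Eventually.of_forall fun w hw => absurd hw.1 hxm

theorem ae_gradX_eq_of_tendsto {C : ℝ≥0} {Z : ℕ → ℝ × ℝ → ℝ} {Y g : ℝ × ℝ → ℝ} {U : Filter ℕ}
    [U.NeBot] {a b c d : ℝ} (hab : a ≤ b) (hU : U ≤ atTop) (hZ : ∀ n, LipschitzWith C (Z n))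
    (hY : Continuous Y) (hlim : ∀ z, Tendsto (fun n => Z n z) U (𝓝 (Y z))) (hg : Measurable g)
    (h : ∀ᵐ z, z ∈ Ioo a b ×ˢ Ioo c d → Tendsto (fun n => gradX (Z n) z) atTop (𝓝 (g z))) :
    ∀ᵐ z, z ∈ Ioo a b ×ˢ Ioo c d → gradX Y z = g z := by
  have hswap : Continuous fun z : ℝ × ℝ => Y z.swap := hY.comp continuous_swap
  have hqs : Measure.QuasiMeasurePreserving (Prod.swap : ℝ × ℝ → ℝ × ℝ) volume volume :=
    Measure.measurePreserving_swap.quasiMeasurePreserving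
  have h1 := ae_gradY_eq_of_tendsto (Z := fun n z => Z n z.swap) (Y := fun z => Y z.swap)
    (g := fun z => g z.swap) (a := c) (b := d) (c := a) (d := b) (C := C) hab hU
    (fun n => by
      refine LipschitzWith.of_dist_le_mul fun z z' => ((hZ n).dist_le_mul _ _).trans_eq ?_
      simp [Prod.dist_eq, max_comm]) hswap
    (fun z => hlim _) (hg.comp measurable_swap)
    ((hqs.ae h).mono fun z hz hz' => hz ⟨hz'.2, hz'.1⟩)
  exact (hqs.ae h1).mono fun z hz hz' => hz ⟨hz'.2, hz'.1⟩

/-! ### Existence of a minimal profile -/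

/-- Almost minimal elements of a decreasing sequence of midpoint convex bounded sets converge. -/
theorem exists_tendsto_of_midpoint_convex {α H : Type*} [NormedAddCommGroup H]
    [InnerProductSpace ℝ H] [CompleteSpace H] {S : ℕ → Set α} (hS : Antitone S)
    (hne : ∀ n, (S n).Nonempty) (G : α → H)
    (hmid : ∀ n, ∀ y ∈ S n, ∀ z ∈ S n, ∃ m ∈ S n, G m = (2⁻¹ : ℝ) • (G y + G z))
    {B : ℝ} (hB : ∀ n, ∀ y ∈ S n, ‖G y‖ ≤ B) :
    ∃ y : ℕ → α, (∀ n, y n ∈ S n) ∧ ∃ g, Tendsto (fun n => G (y n)) atTop (𝓝 g) := by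
  set d : ℕ → ℝ := fun n => sInf ((fun y => ‖G y‖) '' S n) with hd
  have hbdd : ∀ n, BddBelow ((fun y => ‖G y‖) '' S n) := fun n =>
    ⟨0, by rintro _ ⟨y, _, rfl⟩; exact norm_nonneg _⟩
  have hdle : ∀ n, ∀ y ∈ S n, d n ≤ ‖G y‖ := fun n y hy => csInf_le (hbdd n) ⟨y, hy, rfl⟩
  have hd0 : ∀ n, 0 ≤ d n := fun n =>
    le_csInf ((hne n).image _) (by rintro _ ⟨y, _, rfl⟩; exact norm_nonneg _)
  have hdmono : Monotone d := fun n m hnm =>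
    csInf_le_csInf (hbdd n) ((hne m).image _) (image_mono (hS hnm))
  have hdB : ∀ n, d n ≤ B := fun n => by
    obtain ⟨y, hy⟩ := hne n
    exact (hdle n y hy).trans (hB n y hy)
  have hbddA : BddAbove (range d) := ⟨B, by rintro _ ⟨n, rfl⟩; exact hdB n⟩
  have hlim := tendsto_atTop_ciSup hdmono hbddA
  set D := ⨆ n, d n
  have hdD : ∀ n, d n ≤ D := fun n => le_ciSup hbddA n
  have hex : ∀ n : ℕ, ∃ y ∈ S n, ‖G y‖ < d n + 1 / ((n : ℝ) + 1) := fun n => by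
    have hpos : (0 : ℝ) < 1 / ((n : ℝ) + 1) := by positivity
    obtain ⟨_, ⟨y, hy, rfl⟩, hlt⟩ := exists_lt_of_csInf_lt ((hne n).image _)
      (show sInf ((fun y => ‖G y‖) '' S n) < d n + 1 / ((n : ℝ) + 1) by linarith)
    exact ⟨y, hy, hlt⟩
  choose y hy hlt using hex
  refine ⟨y, hy, cauchySeq_tendsto_of_complete ?_⟩
  refine cauchySeq_of_le_tendsto_0
    (fun N => √(4 * (D + 1 / ((N : ℝ) + 1)) ^ 2 - 4 * d N ^ 2)) (fun n m N hn hm => ?_) ?_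
  · rw [dist_eq_norm]
    refine Real.le_sqrt_of_sq_le ?_
    -- The midpoint stays in `S N`, so its norm is at least `d N`; the parallelogram law then bounds
    -- the distance by the gap between `d N` and the norms at the ends.
    obtain ⟨k, hk, hGk⟩ := hmid N (y n) (hS hn (hy n)) (y m) (hS hm (hy m))
    have hpar := parallelogram_law_with_norm ℝ (G (y n)) (G (y m))
    have h1 : ‖G (y n) + G (y m)‖ = 2 * ‖G k‖ := by
      rw [hGk, norm_smul, Real.norm_of_nonneg (by norm_num)]
      ring
    have h2 := hdle N k hk
    have hε : ∀ n, N ≤ n → ‖G (y n)‖ ≤ D + 1 / ((N : ℝ) + 1) := fun n hn => by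
      have : 1 / ((n : ℝ) + 1) ≤ 1 / ((N : ℝ) + 1) :=
        one_div_le_one_div_of_le (by positivity) (by exact_mod_cast Nat.succ_le_succ hn)
      linarith [hlt n, hdD n]
    have h3 := pow_le_pow_left₀ (norm_nonneg _) (hε n hn) 2
    have h4 := pow_le_pow_left₀ (norm_nonneg _) (hε m hm) 2
    have h5 := pow_le_pow_left₀ (hd0 N) h2 2
    rw [h1] at hpar
    nlinarith
  · have h1 : Tendsto (fun N : ℕ => √(4 * (D + 1 / ((N : ℝ) + 1)) ^ 2 - 4 * d N ^ 2)) atTop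
        (𝓝 √(4 * (D + 0) ^ 2 - 4 * D ^ 2)) :=
      (Real.continuous_sqrt.tendsto _).comp ((((tendsto_const_nhds.add
        tendsto_one_div_add_atTop_nhds_zero_nat).pow 2).const_mul 4).sub ((hlim.pow 2).const_mul 4))
    simpa using h1

/-- Gradients are complex-valued so that they lie in a Hilbert space `L²`. -/
noncomputable def complexGrad (Y : ℝ × ℝ → ℝ) (z : ℝ × ℝ) : ℂ := ⟨gradX Y z, gradY Y z⟩

theorem measurable_complexGrad {Y : ℝ × ℝ → ℝ} (h : Continuous Y) : Measurable (complexGrad Y) :=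
  measurable_of_re_im (measurable_gradX h) (measurable_gradY h)

theorem norm_complexGrad_le {Y : ℝ × ℝ → ℝ} (h : LipschitzWith 3 Y) (z : ℝ × ℝ) :
    ‖complexGrad Y z‖ ≤ 6 := by
  refine (Complex.norm_le_abs_re_add_abs_im _).trans ?_
  have h1 : ‖gradX Y z‖ ≤ 3 := norm_deriv_le_of_lipschitz (lipschitz_section_left h z.2)
  have h2 : ‖gradY Y z‖ ≤ 3 := norm_deriv_le_of_lipschitz (lipschitz_section_right h z.1)
  rw [Real.norm_eq_abs] at h1 h2
  simp only [complexGrad]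
  linarith

theorem memLp_complexGrad {Y : ℝ × ℝ → ℝ} (h : LipschitzWith 3 Y) {s : Set (ℝ × ℝ)}
    (hs : volume s ≠ ⊤) : MemLp (complexGrad Y) 2 (volume.restrict s) := by
  have : IsFiniteMeasure (volume.restrict s) := isFiniteMeasure_restrict.2 hs
  exact MemLp.of_bound (measurable_complexGrad h.continuous).aestronglyMeasurable 6
    (Eventually.of_forall fun z => norm_complexGrad_le h z)

theorem isClosed_strip {b t : ℝ → ℝ} (hb : Continuous b) (ht : Continuous t) :
    IsClosed (strip b t) := by
  refine (isClosed_Icc.preimage continuous_fst).inter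
    ((isClosed_le (f := fun z : ℝ × ℝ => b z.1) (g := fun z => √2 * z.2) ?_ ?_).inter
      (isClosed_le (f := fun z : ℝ × ℝ => √2 * z.2) (g := fun z => 1 + t z.1) ?_ ?_))
  all_goals fun_prop

theorem measurableSet_strip {b t : ℝ → ℝ} (hb : Continuous b) (ht : Continuous t) :
    MeasurableSet (strip b t) :=
  (isClosed_strip hb ht).measurableSet

/-- The cost is a convex function of the gradient, so its sublevel sets are midpoint convex and the
abstract lemma gives strong `L²` convergence of gradients along a minimizing sequence. Almost
everywhere convergence of a subsequence is what semicontinuity and Fatou's lemma need. The box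
replaces the strip because its sections are fixed intervals, on which derivatives can be integrated.
-/
theorem exists_totalCost_minimal {b t : ℝ → ℝ} (hb : Continuous b) (ht : Continuous t) {R : ℝ}
    (hR : strip b t ⊆ Ioo (-1 : ℝ) 2 ×ˢ Ioo (-R) R)
    (hfin : ∃ Y, IsProfile b t Y ∧ totalCost b t Y ≠ ⊤) :
    ∃ Y, IsProfile b t Y ∧ ∀ Z, IsProfile b t Z → totalCost b t Y ≤ totalCost b t Z := by
  set box : Set (ℝ × ℝ) := Ioo (-1 : ℝ) 2 ×ˢ Ioo (-R) R with hbox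
  have hboxm : MeasurableSet box := measurableSet_Ioo.prod measurableSet_Ioo
  have hboxf : volume box ≠ ⊤ := by
    rw [hbox, Measure.volume_eq_prod, Measure.prod_prod, Real.volume_Ioo, Real.volume_Ioo]
    exact ENNReal.mul_ne_top ENNReal.ofReal_ne_top ENNReal.ofReal_ne_top
  set μ := volume.restrict box with hμ
  set I : ℝ≥0∞ := ⨅ Y : {Y // IsProfile b t Y}, totalCost b t Y with hI
  have hIfin : I ≠ ⊤ := by
    obtain ⟨Y, hY, hYf⟩ := hfin
    exact ne_top_of_le_ne_top hYf (iInf_le _ (⟨Y, hY⟩ : {Y // IsProfile b t Y}))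
  set S : ℕ → Set {Y // IsProfile b t Y} := fun n => {Y | totalCost b t Y ≤ I + ((n : ℝ≥0∞) + 1)⁻¹}
  have hSanti : Antitone S := fun n m hnm Y (hY : totalCost b t Y ≤ _) =>
    hY.trans (add_le_add le_rfl (ENNReal.inv_le_inv.2 (by gcongr)))
  have hSne : ∀ n, (S n).Nonempty := fun n => by
    have : I < I + ((n : ℝ≥0∞) + 1)⁻¹ := ENNReal.lt_add_right hIfin (by simp)
    obtain ⟨Y, hY⟩ := iInf_lt_iff.1 this
    exact ⟨Y, hY.le⟩
  let G : {Y // IsProfile b t Y} → Lp ℂ 2 μ := fun Y =>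
    (memLp_complexGrad Y.2.lipschitz hboxf).toLp _
  have hGae : ∀ Y, G Y =ᵐ[μ] complexGrad Y := fun Y => MemLp.coeFn_toLp _
  have hmid : ∀ n, ∀ Y ∈ S n, ∀ Z ∈ S n, ∃ M ∈ S n, G M = (2⁻¹ : ℝ) • (G Y + G Z) := by
    intro n Y hY Z hZ
    refine ⟨⟨_, Y.2.midpoint Z.2⟩, ?_, ?_⟩
    · refine (totalCost_midpoint_le Y.2 Z.2).trans ?_
      refine (ENNReal.div_le_div_right (add_le_add hY hZ) 2).trans ?_
      rw [← two_mul, mul_comm, mul_div_assoc, ENNReal.div_self two_ne_zero ENNReal.ofNat_ne_top,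
        mul_one]
    · refine Lp.ext ?_
      filter_upwards [hGae ⟨_, Y.2.midpoint Z.2⟩, hGae Y, hGae Z, Lp.coeFn_smul (2⁻¹ : ℝ) (G Y + G Z),
        Lp.coeFn_add (G Y) (G Z), ae_restrict_of_ae Y.2.ae_differentiableAt,
        ae_restrict_of_ae Z.2.ae_differentiableAt] with z h1 h2 h3 h4 h5 h6 h7
      rw [h1, h4, Pi.smul_apply, h5, Pi.add_apply, h2, h3]
      refine Complex.ext ?_ ?_
      · simp only [complexGrad, gradX_midpoint h6 h7, Complex.real_smul, Complex.re_ofReal_mul,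
          Complex.add_re]
        ring
      · simp only [complexGrad, gradY_midpoint h6 h7, Complex.real_smul, Complex.im_ofReal_mul,
          Complex.add_im]
        ring
  have hfm : IsFiniteMeasure μ := isFiniteMeasure_restrict.2 hboxf
  have hB : ∀ n, ∀ Y ∈ S n, ‖G Y‖ ≤ (measureUnivNNReal μ : ℝ) ^ ((2 : ℝ≥0∞).toReal)⁻¹ * 6 := by
    intro n Y _
    refine Lp.norm_le_of_ae_bound (by norm_num) ?_
    filter_upwards [hGae Y] with z hz
    rw [hz]
    exact norm_complexGrad_le Y.2.lipschitz z
  obtain ⟨y, hyS, g, hg⟩ := exists_tendsto_of_midpoint_convex hSanti hSne G hmid hB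
  obtain ⟨ns, hns, hae⟩ := (tendstoInMeasure_of_tendsto_Lp hg).exists_seq_tendsto_ae
  have hgm : Measurable g := (Lp.stronglyMeasurable g).measurable
  have hconv : ∀ᵐ z, z ∈ box →
      Tendsto (fun n => complexGrad (y (ns n)) z) atTop (𝓝 (g z)) := by
    have h1 : ∀ᵐ z ∂μ, ∀ n, G (y (ns n)) z = complexGrad (y (ns n)) z :=
      ae_all_iff.2 fun n => hGae _
    refine (ae_restrict_iff' hboxm).1 ?_
    filter_upwards [hae, h1] with z hz hz1
    simpa only [hz1] using hz
  -- Values lie in `[0, 1]`, so a nonprincipal ultrafilter gives a pointwise limit everywhere with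
  -- no further extraction.
  have hcpt : ∀ z : ℝ × ℝ, ∃ v, Tendsto (fun n => (y (ns n) : ℝ × ℝ → ℝ) z) (hyperfilter ℕ) (𝓝 v) := by
    intro z
    have := (isCompact_Icc (a := (0 : ℝ)) (b := 1)).ultrafilter_le_nhds
      ((hyperfilter ℕ).map fun n => (y (ns n) : ℝ × ℝ → ℝ) z) (by
        rw [le_principal_iff]
        exact Ultrafilter.mem_map.2 (univ_mem' fun n =>
          ⟨(y (ns n)).2.nonneg z, (y (ns n)).2.le_one z⟩))
    obtain ⟨v, _, hv⟩ := this
    exact ⟨v, hv⟩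
  choose Y hY using hcpt
  have hYp : IsProfile b t Y := IsProfile.of_tendsto (fun n => (y (ns n)).2) hY
  have hU : (hyperfilter ℕ : Filter ℕ) ≤ atTop := by
    rw [← Nat.cofinite_eq_atTop]; exact hyperfilter_le_cofinite
  -- The hypotheses do not exclude negative `R`; the box is then empty.
  have hR' : -R ≤ R ∨ box = ∅ := by
    rcases le_total (-R) R with h | h
    · exact Or.inl h
    · right; rw [hbox, Ioo_eq_empty (not_lt.2 h), prod_empty]
  have hgrad : ∀ᵐ z, z ∈ box → gradX Y z = (g z).re ∧ gradY Y z = (g z).im := by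
    rcases hR' with hR' | hR'
    · have h1 := ae_gradX_eq_of_tendsto (Z := fun n => (y (ns n) : ℝ × ℝ → ℝ)) (Y := Y)
        (g := fun z => (g z).re) (a := -1) (b := 2) (c := -R) (d := R) (by norm_num) hU
        (fun n => (y (ns n)).2.lipschitz) hYp.lipschitz.continuous hY
        (Complex.measurable_re.comp hgm)
        (hconv.mono fun z hz hz' => (Complex.continuous_re.tendsto _).comp (hz hz'))
      have h2 := ae_gradY_eq_of_tendsto (Z := fun n => (y (ns n) : ℝ × ℝ → ℝ)) (Y := Y)
        (g := fun z => (g z).im) (a := -1) (b := 2) (c := -R) (d := R) hR' hU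
        (fun n => (y (ns n)).2.lipschitz) hYp.lipschitz.continuous hY
        (Complex.measurable_im.comp hgm)
        (hconv.mono fun z hz hz' => (Complex.continuous_im.tendsto _).comp (hz hz'))
      filter_upwards [h1, h2] with z h1 h2 hz
      exact ⟨h1 hz, h2 hz⟩
    · simp [hR']
  refine ⟨Y, hYp, fun Z hZ => le_trans (b := I) ?_
    (iInf_le (fun Y : {Y // IsProfile b t Y} => totalCost b t Y) ⟨Z, hZ⟩)⟩
  have hfatou : totalCost b t Y ≤ liminf (fun n => totalCost b t (y (ns n))) atTop := by
    unfold totalCost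
    refine le_trans ?_ (lintegral_liminf_le fun n =>
      measurable_cost_grad (y (ns n)).2.lipschitz.continuous)
    refine lintegral_mono_ae ((ae_restrict_iff' (measurableSet_strip hb ht)).2 ?_)
    filter_upwards [hgrad, hconv, ae_all_iff.2 fun n => (y (ns n)).2.ae_slope_mem]
      with z h1 h2 h3 hz
    rw [(h1 (hR hz)).1, (h1 (hR hz)).2]
    have h2 := h2 (hR hz)
    exact cost_le_liminf ((Complex.continuous_re.tendsto _).comp h2)
      ((Complex.continuous_im.tendsto _).comp h2) (fun n => (h3 n).1) (fun n => (h3 n).2)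
  refine hfatou.trans ?_
  have h1 : Tendsto (fun n : ℕ => I + ((n : ℝ≥0∞) + 1)⁻¹) atTop (𝓝 (I + 0)) := by
    refine tendsto_const_nhds.add ?_
    have := (tendsto_add_atTop_iff_nat 1).2 ENNReal.tendsto_inv_nat_nhds_zero
    simpa using this
  rw [add_zero] at h1
  rw [← (h1.comp hns.tendsto_atTop).liminf_eq]
  exact liminf_le_liminf (Eventually.of_forall fun n => hyS (ns n))

/-! ### A profile is determined by its derivative in `w` -/

/-- By Fubini, for almost every `x` the derivative can be integrated upward from the lower curve,
where both profiles vanish. Continuity in `x` reaches the remaining `x`. -/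
theorem eq_of_gradY_ae_eq {b t : ℝ → ℝ} {Y Z : ℝ × ℝ → ℝ} (hb : Continuous b) (ht : Continuous t)
    (hY : IsProfile b t Y) (hZ : IsProfile b t Z)
    (h : ∀ᵐ z ∂(volume.restrict (strip b t)), gradY Y z = gradY Z z) {x : ℝ}
    (hx : x ∈ Icc (0 : ℝ) 1) (w : ℝ) : Y (x, w) = Z (x, w) := by
  have hs := sqrt_two_pos
  have h1 := (ae_restrict_iff' (measurableSet_strip hb ht)).1 h
  rw [Measure.volume_eq_prod] at h1
  have h2 : ∀ᵐ x : ℝ, x ∈ Icc (0 : ℝ) 1 → ∀ w, Y (x, w) = Z (x, w) := by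
    filter_upwards [Measure.ae_ae_of_ae_prod h1] with x hx hx01 w
    rcases le_total (√2 * w) (b x) with hw | hw
    · rw [hY.bot x w hw, hZ.bot x w hw]
    rcases le_total (1 + t x) (√2 * w) with hw' | hw'
    · rw [hY.top x w hw', hZ.top x w hw']
    have e0 : √2 * (b x / √2) = b x := by field_simp
    have hle : b x / √2 ≤ w := by rw [div_le_iff₀ hs]; linarith
    have hint : ∫ u in (b x / √2)..w, deriv (fun u => Y (x, u)) u =
        ∫ u in (b x / √2)..w, deriv (fun u => Z (x, u)) u := by
      refine intervalIntegral.integral_congr_ae (hx.mono fun u hu hu' => hu ?_)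
      rw [uIoc_of_le hle] at hu'
      refine ⟨hx01, ?_, ?_⟩
      · rw [← e0]; exact mul_le_mul_of_nonneg_left hu'.1.le hs.le
      · exact (mul_le_mul_of_nonneg_left hu'.2 hs.le).trans hw'
    rw [integral_deriv_of_lipschitz (lipschitz_section_right hY.lipschitz x),
      integral_deriv_of_lipschitz (lipschitz_section_right hZ.lipschitz x),
      hY.bot x _ e0.le, hZ.bot x _ e0.le] at hint
    linarith
  refine Measure.eqOn_Icc_of_ae_eq volume (f := fun x => Y (x, w)) (g := fun x => Z (x, w))
    zero_ne_one ?_ (lipschitz_section_left hY.lipschitz w).continuous.continuousOn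
    (lipschitz_section_left hZ.lipschitz w).continuous.continuousOn hx
  exact (ae_restrict_iff' measurableSet_Icc).2 (h2.mono fun x hx hx' => hx hx' w)

/-! ### Boundary curves and absence of flat pieces -/

/-- A pair of boundary curves, extended to the whole line. -/
structure IsBoundaryPair (b t : ℝ → ℝ) : Prop where
  lip_bot : ∀ x x', |b x - b x'| ≤ |x - x'| / 2
  lip_top : ∀ x x', |t x - t x'| ≤ |x - x'| / 2
  le : ∀ x, b x ≤ t x
  left : b 0 = t 0
  right : b 1 = t 1

theorem lipschitzWith_half {f : ℝ → ℝ} (h : ∀ x x', |f x - f x'| ≤ |x - x'| / 2) :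
    LipschitzWith (1 / 2) f :=
  LipschitzWith.of_dist_le_mul fun x x' => (h x x').trans_eq (by
    rw [Real.dist_eq]; push_cast; ring)

theorem IsBoundaryPair.continuous_bot {b t : ℝ → ℝ} (h : IsBoundaryPair b t) : Continuous b :=
  (lipschitzWith_half h.lip_bot).continuous

theorem IsBoundaryPair.continuous_top {b t : ℝ → ℝ} (h : IsBoundaryPair b t) : Continuous t :=
  (lipschitzWith_half h.lip_top).continuous

/-- A profile of finite cost is strictly increasing: the surface has no vertical pieces. -/
theorem IsProfile.lt_of_totalCost_ne_top {b t : ℝ → ℝ} {Y : ℝ × ℝ → ℝ} (hbt : IsBoundaryPair b t)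
    (hY : IsProfile b t Y) (hf : totalCost b t Y ≠ ⊤) {x w₁ w₂ : ℝ} (hx : x ∈ Icc (0 : ℝ) 1)
    (h₁ : b x ≤ √2 * w₁) (h₂ : √2 * w₂ ≤ 1 + t x) (hw : w₁ < w₂) : Y (x, w₁) < Y (x, w₂) := by
  have hs := sqrt_two_pos
  by_contra hcon
  have heq : Y (x, w₁) = Y (x, w₂) := le_antisymm (hY.mono hw.le) (not_lt.1 hcon)
  -- The open diamond with vertices `(x, w₁)` and `(x, w₂)`, cut to `0 < z.1 < 1`. By `cone`, values
  -- in it lie between the equal values at these vertices. It stays in the strip because the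
  -- boundary curves are `1/2`-Lipschitz.
  set O : Set (ℝ × ℝ) := {z | |x - z.1| < 2 * √2 * ((w₂ - w₁) / 2 - |z.2 - (w₁ + w₂) / 2|)} ∩
    Ioo (0 : ℝ) 1 ×ˢ univ with hO
  have hOo : IsOpen O := by
    refine IsOpen.inter (isOpen_lt ?_ ?_) (isOpen_Ioo.prod isOpen_univ) <;> fun_prop
  have hbd : ∀ z ∈ O, |x - z.1| ≤ 2 * √2 * (z.2 - w₁) ∧ |x - z.1| ≤ 2 * √2 * (w₂ - z.2) := by
    intro z hz
    have h0 : |x - z.1| < _ := hz.1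
    have h3 := neg_abs_le (z.2 - (w₁ + w₂) / 2)
    have h4 := le_abs_self (z.2 - (w₁ + w₂) / 2)
    constructor
    · refine h0.le.trans (mul_le_mul_of_nonneg_left ?_ (by positivity)); linarith
    · refine h0.le.trans (mul_le_mul_of_nonneg_left ?_ (by positivity)); linarith
  have hconst : ∀ z ∈ O, Y z = Y (x, w₁) := fun z hz => by
    refine le_antisymm ?_ (hY.cone x z.1 w₁ z.2 (hbd z hz).1)
    rw [heq]
    refine hY.cone z.1 x z.2 w₂ ?_
    rw [abs_sub_comm]
    exact (hbd z hz).2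
  have hsub : O ⊆ strip b t := fun z hz => by
    have h3 := (hbd z hz).1
    have h4 := (hbd z hz).2
    have h5 := (abs_le.1 (hbt.lip_bot x z.1)).1
    have h6 := (abs_le.1 (hbt.lip_top x z.1)).2
    refine ⟨Ioo_subset_Icc_self hz.2.1, ?_, ?_⟩ <;> nlinarith
  have hcost : ∀ z ∈ O, cost (gradX Y z) (gradY Y z) = ⊤ := fun z hz => by
    have : gradY Y z = 0 := by
      have hev : (fun w => Y (z.1, w)) =ᶠ[𝓝 z.2] fun _ => Y (x, w₁) := by
        have hc : Continuous fun w : ℝ => (z.1, w) := by fun_prop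
        filter_upwards [hc.continuousAt.preimage_mem_nhds (hOo.mem_nhds hz)] with w hw
        exact hconst _ hw
      rw [gradY, hev.deriv_eq, deriv_const]
    rw [this, cost_zero_right]
  have hne : O.Nonempty := by
    -- When `x` is 0 or 1 only half of the diamond remains, so the witness is moved slightly inside.
    obtain ⟨x', hx', hxx'⟩ : ∃ x' ∈ Ioo (0 : ℝ) 1, |x - x'| < 2 * √2 * ((w₂ - w₁) / 2) := by
      have hx2 : x ∈ closure (Ioo (0 : ℝ) 1) := by rwa [closure_Ioo zero_ne_one]
      have hpos : 0 < 2 * √2 * ((w₂ - w₁) / 2) := mul_pos (by positivity) (by linarith)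
      obtain ⟨x', h, h'⟩ := Metric.mem_closure_iff.1 hx2 _ hpos
      exact ⟨x', h, by rwa [Real.dist_eq] at h'⟩
    refine ⟨(x', (w₁ + w₂) / 2), ?_, hx', mem_univ _⟩
    simpa using hxx'
  refine hf (top_le_iff.1 ?_)
  calc ⊤ = ∫⁻ _ in O, ⊤ := by
        rw [setLIntegral_const, ENNReal.top_mul (hOo.measure_pos volume hne).ne']
    _ = ∫⁻ z in O, cost (gradX Y z) (gradY Y z) :=
        (setLIntegral_congr_fun hOo.measurableSet fun z hz => hcost z hz).symm
    _ ≤ _ := lintegral_mono_set hsub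

theorem IsBoundaryPair.strip_subset {b t : ℝ → ℝ} (h : IsBoundaryPair b t) :
    ∃ R, strip b t ⊆ Ioo (-1 : ℝ) 2 ×ˢ Ioo (-R) R := by
  refine ⟨|b 0| + |t 0| + 4, fun z hz => ?_⟩
  obtain ⟨⟨h0, h1⟩, h2, h3⟩ := hz
  have hs := sqrt_two_pos
  have hs2 := sqrt_two_lt_two
  have h22 := sqrt_two_mul_self
  have h4 := abs_le.1 (h.lip_bot z.1 0)
  have h5 := abs_le.1 (h.lip_top z.1 0)
  rw [sub_zero, abs_of_nonneg h0] at h4 h5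
  have h6 := neg_abs_le (b 0)
  have h7 := le_abs_self (t 0)
  have h8 := abs_nonneg (b 0)
  have h9 := abs_nonneg (t 0)
  have h10 : 1 < √2 := by nlinarith
  exact ⟨⟨by linarith, by linarith⟩, by nlinarith, by nlinarith⟩

/-! ### From admissible functions to profiles -/

noncomputable def clampI (x : ℝ) : unitInterval := projIcc (0 : ℝ) 1 zero_le_one x

theorem clampI_of_mem {x : ℝ} (hx : x ∈ Icc (0 : ℝ) 1) : clampI x = ⟨x, hx⟩ := projIcc_of_mem _ hx

theorem clampI_coe (x : unitInterval) : clampI x = x := projIcc_val _ x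

theorem abs_clampI_sub_le (x x' : ℝ) : |(clampI x : ℝ) - clampI x'| ≤ |x - x'| :=
  abs_projIcc_sub_projIcc zero_le_one

noncomputable def botFun (hb : squareBoundary → ℝ) (x : ℝ) : ℝ := hb (bottomPt (clampI x))

noncomputable def topFun (hb : squareBoundary → ℝ) (x : ℝ) : ℝ := hb (topPt (clampI x))

theorem abs_sub_le_of_lipschitz {f : unitInterval → ℝ} (hf : LipschitzWith (1 / 2) f)
    (x x' : unitInterval) : |f x - f x'| ≤ |(x : ℝ) - x'| / 2 := by
  have := hf.dist_le_mul x x'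
  rw [Real.dist_eq, Subtype.dist_eq, Real.dist_eq] at this
  push_cast at this
  linarith

theorem lipschitz_of_abs_sub_le {f : unitInterval → ℝ}
    (hf : ∀ x x' : unitInterval, |f x - f x'| ≤ |(x : ℝ) - x'| / 2) : LipschitzWith (1 / 2) f :=
  LipschitzWith.of_dist_le_mul fun x x' => (hf x x').trans_eq (by
    rw [Subtype.dist_eq, Real.dist_eq]; push_cast; ring)

theorem IsBoundaryCondition.isBoundaryPair {hb : squareBoundary → ℝ}
    (h : IsBoundaryCondition hb) : IsBoundaryPair (botFun hb) (topFun hb) where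
  lip_bot x x' := (abs_sub_le_of_lipschitz h.bottom_lipschitz _ _).trans (by
    linarith [abs_clampI_sub_le x x'])
  lip_top x x' := (abs_sub_le_of_lipschitz h.top_lipschitz _ _).trans (by
    linarith [abs_clampI_sub_le x x'])
  le x := h.bottom_le_top _
  left := by
    obtain ⟨C, hC⟩ := h.left_const
    have h1 : clampI 0 = 0 := clampI_coe 0
    rw [botFun, topFun, h1]
    exact (hC 0).trans (hC 1).symm
  right := by
    obtain ⟨C, hC⟩ := h.right_const
    have h1 : clampI 1 = 1 := clampI_coe 1
    rw [botFun, topFun, h1]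
    exact (hC 0).trans (hC 1).symm

theorem turnedDomain_eq_strip (hb : squareBoundary → ℝ) :
    turnedDomain hb = strip (botFun hb) (topFun hb) := by
  have hs := sqrt_two_pos
  have h22 := sqrt_two_mul_self
  have e1 : ∀ a : ℝ, √2 * (√2 / 2 * a) = a := fun a => by linear_combination a / 2 * h22
  have key : ∀ a b : ℝ, √2 / 2 * a ≤ b ↔ a ≤ √2 * b := fun a b => by
    rw [← mul_le_mul_iff_of_pos_left hs, e1]
  have key' : ∀ a b : ℝ, b ≤ √2 / 2 * a ↔ √2 * b ≤ a := fun a b => by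
    rw [← mul_le_mul_iff_of_pos_left hs, e1]
  ext ⟨x, w⟩
  simp only [turnedDomain, strip, mem_ofPred_eq, key, key']
  constructor
  · rintro ⟨u, rfl, h1, h2⟩
    exact ⟨u.2, by rwa [botFun, clampI_coe], by rwa [topFun, clampI_coe]⟩
  · rintro ⟨hx, h1, h2⟩
    rw [botFun, clampI_of_mem hx] at h1
    rw [topFun, clampI_of_mem hx] at h2
    exact ⟨⟨x, hx⟩, rfl, h1, h2⟩

/-- The profile of an admissible function. -/
noncomputable def heightProfile (h : unitInterval × unitInterval → ℝ) (z : ℝ × ℝ) : ℝ :=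
  (sSup {y : unitInterval | (y : ℝ) + h (clampI z.1, y) ≤ √2 * z.2} : unitInterval)

theorem le_of_lt_sSup {f : unitInterval → ℝ} (hf : Monotone f) {c : ℝ} {y : unitInterval}
    (h : y < sSup {y : unitInterval | (y : ℝ) + f y ≤ c}) : (y : ℝ) + f y ≤ c := by
  obtain ⟨a, ha, hya⟩ := lt_sSup_iff.1 h
  have h2 : (a : ℝ) + f a ≤ c := ha
  have h3 : (y : ℝ) < a := hya
  linarith [hf hya.le]

theorem lt_of_sSup_lt {f : unitInterval → ℝ} {c : ℝ} {y : unitInterval}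
    (h : sSup {y : unitInterval | (y : ℝ) + f y ≤ c} < y) : c < (y : ℝ) + f y := by
  by_contra hcon
  exact absurd (le_sSup (show y ∈ {y : unitInterval | (y : ℝ) + f y ≤ c} from not_lt.1 hcon))
    (not_le.2 h)

theorem sSup_eq_of_forall {f : unitInterval → ℝ} {c : ℝ} {v : unitInterval}
    (h1 : ∀ y < v, (y : ℝ) + f y ≤ c) (h2 : ∀ y, v < y → c < (y : ℝ) + f y) :
    sSup {y : unitInterval | (y : ℝ) + f y ≤ c} = v := by
  refine le_antisymm (sSup_le fun y (hy : (y : ℝ) + f y ≤ c) => ?_) ?_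
  · by_contra hcon
    linarith [h2 y (not_le.1 hcon)]
  · exact le_of_forall_lt_imp_le_of_dense fun y hy => le_sSup (h1 y hy)

theorem IsAdmissible.bot_eq {hb : squareBoundary → ℝ} {h : unitInterval × unitInterval → ℝ}
    (hh : IsAdmissible hb h) (x : unitInterval) : h (x, 0) = hb (bottomPt x) :=
  hh.boundary (bottomPt x)

theorem IsAdmissible.top_eq {hb : squareBoundary → ℝ} {h : unitInterval × unitInterval → ℝ}
    (hh : IsAdmissible hb h) (x : unitInterval) : h (x, 1) = hb (topPt x) :=
  hh.boundary (topPt x)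

/-- For `cone` and `lip`, a violation leaves room for intermediate heights, one inside the set
defining a supremum and one outside the other set. Comparing `y + h` at these heights contradicts
the Lipschitz bound in `x` together with monotonicity, respectively monotonicity alone. -/
theorem IsAdmissible.isProfile {hb : squareBoundary → ℝ} {h : unitInterval × unitInterval → ℝ}
    (hh : IsAdmissible hb h) : IsProfile (botFun hb) (topFun hb) (heightProfile h) where
  bot x w hw := by
    rw [botFun, ← hh.bot_eq] at hw
    -- The set is empty or `{0}`; in the complete lattice `unitInterval` the empty supremum is 0.
    have : sSup {y : unitInterval | (y : ℝ) + h (clampI x, y) ≤ √2 * w} = 0 := by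
      refine sSup_eq_of_forall (f := fun y => h (clampI x, y))
        (fun y hy => absurd hy (not_lt.2 unitInterval.nonneg')) fun y hy => ?_
      have h1 : h (clampI x, 0) ≤ h (clampI x, y) := hh.mono _ hy.le
      have h2 : (0 : ℝ) < y := hy
      linarith
    simp only [heightProfile, this, Icc.coe_zero]
  top x w hw := by
    rw [topFun, ← hh.top_eq] at hw
    have : sSup {y : unitInterval | (y : ℝ) + h (clampI x, y) ≤ √2 * w} = 1 := by
      refine sSup_eq_of_forall (f := fun y => h (clampI x, y)) (fun y hy => ?_)
        fun y hy => absurd hy (not_lt.2 unitInterval.le_one')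
      have h1 : h (clampI x, y) ≤ h (clampI x, 1) := hh.mono _ hy.le
      have h2 : (y : ℝ) < 1 := hy
      linarith
    simp only [heightProfile, this, Icc.coe_one]
  cone x x' w w' hw := by
    by_contra hcon
    have hcon := not_le.1 hcon
    simp only [heightProfile] at hcon
    obtain ⟨y₁, h1, h1'⟩ := exists_between (Subtype.coe_lt_coe.1 hcon)
    obtain ⟨y₂, h2, h2'⟩ := exists_between h1'
    have e1 := lt_of_sSup_lt (f := fun y => h (clampI x', y)) h1
    have e2 := le_of_lt_sSup (hh.mono (clampI x)) h2'
    have e3 : h (clampI x, y₁) ≤ h (clampI x, y₂) := hh.mono _ h2.le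
    have e4 := abs_le.1 (abs_sub_le_of_lipschitz (hh.lipschitz y₁) (clampI x) (clampI x'))
    have e5 := abs_clampI_sub_le x x'
    have e6 : (y₁ : ℝ) < y₂ := h2
    linarith
  lip x w w' hw := by
    by_contra hcon
    have hcon := not_le.1 hcon
    simp only [heightProfile] at hcon
    have hs := sqrt_two_pos
    set v := sSup {y : unitInterval | (y : ℝ) + h (clampI x, y) ≤ √2 * w} with hv
    set v' := sSup {y : unitInterval | (y : ℝ) + h (clampI x, y) ≤ √2 * w'} with hv'
    have hd : 0 ≤ √2 * (w' - w) := mul_nonneg hs.le (by linarith)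
    obtain ⟨a, ha, ha'⟩ := exists_between (show (v : ℝ) + √2 * (w' - w) < v' by linarith)
    have hv0 := v.2.1
    have hv1 := v'.2.2
    have haI : a ∈ Icc (0 : ℝ) 1 := ⟨by linarith, by linarith⟩
    have haI' : a - √2 * (w' - w) ∈ Icc (0 : ℝ) 1 := ⟨by linarith, by linarith⟩
    have e1 := le_of_lt_sSup (hh.mono (clampI x)) (c := √2 * w') (y := ⟨a, haI⟩)
      (Subtype.coe_lt_coe.1 ha')
    have e2 := lt_of_sSup_lt (f := fun y => h (clampI x, y)) (c := √2 * w)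
      (y := ⟨a - √2 * (w' - w), haI'⟩) (Subtype.coe_lt_coe.1 (show (v : ℝ) < _ by
        change (v : ℝ) < a - √2 * (w' - w); linarith))
    have e3 : h (clampI x, ⟨a - √2 * (w' - w), haI'⟩) ≤ h (clampI x, ⟨a, haI⟩) :=
      hh.mono _ (Subtype.coe_le_coe.1 (by change a - √2 * (w' - w) ≤ a; linarith))
    linarith

theorem turned_eq {hb : squareBoundary → ℝ} {h : unitInterval × unitInterval → ℝ}
    (hh : h ∈ admissible hb) (q : turnedDomain hb) :
    turned hb h q = q.1.2 - √2 * heightProfile h q.1 := by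
  have h22 := sqrt_two_mul_self
  have hmem : (q.1.1, q.1.2, turned hb h q) ∈ turn '' surface h := by
    rw [image_turn_surface hh]
    exact ⟨q.2, rfl⟩
  obtain ⟨⟨_, _, z⟩, ⟨x, y, rfl, rfl, hl, hr⟩, he⟩ := hmem
  simp only [turn, Prod.mk.injEq] at he hl hr
  obtain ⟨e1, e2, e3⟩ := he
  have hc : √2 * q.1.2 = y + z := by
    rw [← e2]; linear_combination (y + z) / 2 * h22
  have hsup : heightProfile h q.1 = y := by
    rw [heightProfile, ← e1, clampI_coe, hc]
    congr 1
    refine sSup_eq_of_forall (f := fun y => h (x, y)) (fun y' hy' => ?_) fun y' hy' => ?_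
    · have h1 := (hh.mono x).le_leftLim hy'
      have h2 : (y' : ℝ) < y := hy'
      linarith
    · have h1 := (hh.mono x).rightLim_le hy'
      have h2 : (y : ℝ) < y' := hy'
      linarith
  rw [hsup, ← e3]
  have hz : z = √2 * q.1.2 - y := by linarith
  rw [hz]
  linear_combination (q.1.2 / 2) * h22

/-! ### Entropy as area minus total cost -/

/-- The boundary of the strip is null. `extendZero` has meaningful partial derivatives only at
interior points. -/
theorem ae_mem_nhds_strip {b t : ℝ → ℝ} (hb : Continuous b) (ht : Continuous t) :
    ∀ᵐ z : ℝ × ℝ, z ∈ strip b t → strip b t ∈ 𝓝 z := by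
  have hs := sqrt_two_pos
  set O : Set (ℝ × ℝ) := {z | z.1 ∈ Ioo (0 : ℝ) 1} ∩
    ({z | b z.1 < √2 * z.2} ∩ {z | √2 * z.2 < 1 + t z.1}) with hO
  have hOo : IsOpen O := by
    refine (isOpen_Ioo.preimage continuous_fst).inter
      (IsOpen.inter (isOpen_lt ?_ ?_) (isOpen_lt ?_ ?_)) <;> fun_prop
  have hsub : O ⊆ strip b t := fun z hz => ⟨Ioo_subset_Icc_self hz.1, hz.2.1.le, hz.2.2.le⟩
  suffices h : ∀ᵐ z : ℝ × ℝ, z ∈ strip b t → z ∈ O from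
    h.mono fun z hz hz' => mem_of_superset (hOo.mem_nhds (hz hz')) hsub
  have hm : MeasurableSet {z | z ∈ strip b t → z ∈ O} :=
    (measurableSet_strip hb ht).imp hOo.measurableSet
  have hne : ∀ a : ℝ, ∀ᵐ x : ℝ, x ≠ a := fun a => by simp [ae_iff, measure_singleton]
  rw [Measure.volume_eq_prod]
  refine (Measure.ae_prod_iff_ae_ae hm).2 ?_
  filter_upwards [hne 0, hne 1] with x h0 h1
  filter_upwards [hne (b x / √2), hne ((1 + t x) / √2)] with w h2 h3 hz
  rw [ne_eq, eq_div_iff hs.ne', mul_comm] at h2 h3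
  obtain ⟨⟨g0, g1⟩, g2, g3⟩ := hz
  exact ⟨⟨lt_of_le_of_ne g0 (Ne.symm h0), lt_of_le_of_ne g1 h1⟩,
    lt_of_le_of_ne g2 (Ne.symm h2), lt_of_le_of_ne g3 h3⟩

/-- Here `a` and `m` stand for the integrals of the positive and negative parts of the entropy, `v`
for the area and `n` for the cost. The additive hypothesis makes sense when `n` and `m` are
infinite, and then both differences are `⊥`. -/
theorem ereal_sub_eq {a m n v : ℝ≥0∞} (h : n + a = v + m) (ha : a ≠ ⊤) (hv : v ≠ ⊤) :
    (a : EReal) - (m : EReal) = (v : EReal) - (n : EReal) := by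
  by_cases hn : n = ⊤
  · have hm : m = ⊤ := by
      subst hn
      rw [top_add] at h
      exact (ENNReal.add_eq_top.1 h.symm).resolve_left hv
    subst hn hm
    rw [EReal.coe_ennreal_top, EReal.sub_top, EReal.sub_top]
  · have hm : m ≠ ⊤ := fun hm => by
      rw [hm, add_top] at h
      exact ENNReal.add_ne_top.2 ⟨hn, ha⟩ h
    lift a to ℝ≥0 using ha
    lift m to ℝ≥0 using hm
    lift n to ℝ≥0 using hn
    lift v to ℝ≥0 using hv
    have h' : (n : ℝ) + a = v + m := by exact_mod_cast h
    have e : ∀ r : ℝ≥0, ((r : ℝ≥0∞) : EReal) = ((r : ℝ) : EReal) := fun r => rfl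
    rw [e, e, e, e, ← EReal.coe_sub, ← EReal.coe_sub]
    congr 1
    linarith

theorem IsBoundaryPair.volume_strip_ne_top {b t : ℝ → ℝ} (h : IsBoundaryPair b t) :
    volume (strip b t) ≠ ⊤ := by
  obtain ⟨R, hR⟩ := h.strip_subset
  refine ne_top_of_le_ne_top ?_ (measure_mono hR)
  rw [Measure.volume_eq_prod, Measure.prod_prod, Real.volume_Ioo, Real.volume_Ioo]
  exact ENNReal.mul_ne_top ENNReal.ofReal_ne_top ENNReal.ofReal_ne_top

theorem partial_turned {hb : squareBoundary → ℝ} {h : unitInterval × unitInterval → ℝ}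
    (hh : h ∈ admissible hb) {z : ℝ × ℝ} (hz : turnedDomain hb ∈ 𝓝 z)
    (hd : DifferentiableAt ℝ (heightProfile h) z) :
    partialX (turned hb h) z = -(√2 * gradX (heightProfile h) z) ∧
      partialY (turned hb h) z = 1 - √2 * gradY (heightProfile h) z := by
  have hev : ∀ᶠ p in 𝓝 z, extendZero (turned hb h) p = p.2 - √2 * heightProfile h p := by
    filter_upwards [hz] with p hp
    rw [extendZero, dif_pos hp, turned_eq hh]
  constructor
  · have hc : Continuous fun x : ℝ => (x, z.2) := by fun_prop
    have h1 : (fun x => extendZero (turned hb h) (x, z.2)) =ᶠ[𝓝 z.1]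
        fun x => z.2 - √2 * heightProfile h (x, z.2) :=
      (hc.tendsto z.1).eventually hev
    rw [partialX, h1.deriv_eq]
    exact (((hasDerivAt_gradX hd).const_mul √2).const_sub z.2).deriv
  · have hc : Continuous fun w : ℝ => (z.1, w) := by fun_prop
    have h1 : (fun w => extendZero (turned hb h) (z.1, w)) =ᶠ[𝓝 z.2]
        fun w => w - √2 * heightProfile h (z.1, w) :=
      (hc.tendsto z.2).eventually hev
    rw [partialY, h1.deriv_eq]
    exact ((hasDerivAt_id _).sub ((hasDerivAt_gradY hd).const_mul √2)).deriv

theorem entropy_eq {hb : squareBoundary → ℝ} (hhb : IsBoundaryCondition hb)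
    {h : unitInterval × unitInterval → ℝ} (hh : h ∈ admissible hb) :
    entropy hb h = (volume (strip (botFun hb) (topFun hb)) : EReal) -
      (totalCost (botFun hb) (topFun hb) (heightProfile h) : EReal) := by
  have hbt := hhb.isBoundaryPair
  have hp := hh.isProfile
  have hD := turnedDomain_eq_strip hb
  have hvol := hbt.volume_strip_ne_top
  have hms := measurableSet_strip hbt.continuous_bot hbt.continuous_top
  have hnhds := ae_mem_nhds_strip hbt.continuous_bot hbt.continuous_top
  rw [← hD] at hms hnhds
  have hae : ∀ᵐ z ∂(volume.restrict (turnedDomain hb)),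
      cost (gradX (heightProfile h) z) (gradY (heightProfile h) z) +
        (turnedEnt (partialX (turned hb h) z) (partialY (turned hb h) z)).toENNReal =
      1 + (-turnedEnt (partialX (turned hb h) z) (partialY (turned hb h) z)).toENNReal ∧
      (turnedEnt (partialX (turned hb h) z) (partialY (turned hb h) z)).toENNReal ≤ 1 := by
    refine (ae_restrict_iff' hms).2 ?_
    filter_upwards [hnhds, hp.ae_differentiableAt] with z h1 h2 hz
    obtain ⟨e1, e2⟩ := partial_turned hh (h1 hz) h2
    rw [e1, e2]
    exact cost_add_turnedEnt (hp.slope_mem h2).1 (hp.slope_mem h2).2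
  rw [← hD] at hvol
  rw [entropy, turnedEntropy, integralEReal, totalCost, ← hD]
  refine ereal_sub_eq ?_ ?_ hvol
  · rw [← lintegral_add_left (measurable_cost_grad hp.lipschitz.continuous),
      lintegral_congr_ae (hae.mono fun z hz => hz.1), lintegral_add_left measurable_const,
      setLIntegral_one]
  · refine ne_top_of_le_ne_top hvol ?_
    rw [← setLIntegral_one]
    exact lintegral_mono_ae (hae.mono fun z hz => hz.2)

/-! ### From profiles back to admissible functions -/

/-- The height `y + z` at which the profile over `x` reaches the value `y`. -/
noncomputable def level (Y : ℝ × ℝ → ℝ) (x y : ℝ) : ℝ := sInf {c : ℝ | y ≤ Y (x, c / √2)}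

section level

variable {b t : ℝ → ℝ} {Y : ℝ × ℝ → ℝ} {x y : ℝ}

/-- Positivity of `y` matters: the profile vanishes below the lower curve, so the set defining
`level` is bounded below only for `y > 0`. -/
theorem IsProfile.add_le_of_le (hY : IsProfile b t Y) (hy : 0 < y) {c : ℝ}
    (hc : y ≤ Y (x, c / √2)) : b x + y ≤ c := by
  have hs := sqrt_two_pos
  have e : ∀ a : ℝ, √2 * (a / √2) = a := fun a => by field_simp
  have h0 := hY.bot x (b x / √2) (e _).le
  rcases le_total c (b x) with h | h
  · have := hY.bot x (c / √2) ((e c).trans_le h)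
    linarith
  · have h1 := hY.lip x (b x / √2) (c / √2) (by gcongr)
    rw [mul_sub, e, e] at h1
    linarith

theorem IsProfile.level_le (hY : IsProfile b t Y) (hy : 0 < y) {c : ℝ}
    (hc : y ≤ Y (x, c / √2)) : level Y x y ≤ c :=
  csInf_le ⟨b x + y, fun _ h => hY.add_le_of_le hy h⟩ hc

theorem IsProfile.le_level (hY : IsProfile b t Y) (hy : 0 < y) (hy1 : y ≤ 1) :
    y ≤ Y (x, level Y x y / √2) := by
  have hcl : IsClosed {c : ℝ | y ≤ Y (x, c / √2)} := by
    have hc := (lipschitz_section_right hY.lipschitz x).continuous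
    exact isClosed_le continuous_const (hc.comp (continuous_id.div_const _))
  refine hcl.csInf_mem ⟨1 + t x, ?_⟩ ⟨b x + y, fun _ h => hY.add_le_of_le hy h⟩
  have e : √2 * ((1 + t x) / √2) = 1 + t x := by field_simp
  have := hY.top x _ e.ge
  change y ≤ Y (x, (1 + t x) / √2)
  linarith

/-- The Galois connection making `level` the generalized inverse of the profile in `w`. -/
theorem IsProfile.level_le_iff (hY : IsProfile b t Y) (hy : 0 < y) (hy1 : y ≤ 1) {c : ℝ} :
    level Y x y ≤ c ↔ y ≤ Y (x, c / √2) :=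
  ⟨fun h => (hY.le_level hy hy1).trans (hY.mono (by gcongr)), hY.level_le hy⟩

theorem IsProfile.add_le_level (hY : IsProfile b t Y) (hy : 0 < y) (hy1 : y ≤ 1) :
    b x + y ≤ level Y x y :=
  hY.add_le_of_le hy (hY.le_level hy hy1)

theorem IsProfile.le_apply_sub (hY : IsProfile b t Y) {c δ y' : ℝ} (hδ : 0 ≤ δ)
    (hc : y' ≤ Y (x, c / √2)) : y' - δ ≤ Y (x, (c - δ) / √2) := by
  have h1 := hY.lip x ((c - δ) / √2) (c / √2) (by gcongr; linarith)
  have e : √2 * (c / √2 - (c - δ) / √2) = δ := by field_simp; ring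
  linarith

theorem IsProfile.level_le_add (hY : IsProfile b t Y) (hy : 0 < y) (hy1 : y ≤ 1) :
    level Y x y ≤ t x + y := by
  have e : √2 * ((1 + t x) / √2) = 1 + t x := by field_simp
  have h1 := hY.le_apply_sub (x := x) (y' := 1) (δ := 1 - y) (c := 1 + t x) (by linarith)
    (hY.top x _ e.ge).ge
  refine hY.level_le hy ?_
  rw [show t x + y = 1 + t x - (1 - y) by ring]
  linarith

/-- It says that `level Y x y - y` is nondecreasing in `y`, that is, the height recovered from the
profile is monotone. -/
theorem IsProfile.level_add_le (hY : IsProfile b t Y) (hy : 0 < y) {y' : ℝ} (hyy : y ≤ y')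
    (hy1 : y' ≤ 1) : level Y x y + (y' - y) ≤ level Y x y' := by
  have h1 := hY.le_apply_sub (δ := y' - y) (by linarith) (hY.le_level (x := x) (hy.trans_le hyy) hy1)
  have h2 := hY.level_le (x := x) hy (c := level Y x y' - (y' - y)) (by linarith)
  linarith

theorem IsProfile.level_lipschitz (hY : IsProfile b t Y) (hy : 0 < y) (hy1 : y ≤ 1) (x' : ℝ) :
    |level Y x y - level Y x' y| ≤ |x - x'| / 2 := by
  have key : ∀ x x' : ℝ, level Y x' y ≤ level Y x y + |x - x'| / 2 := fun x x' => by
    refine hY.level_le hy ((hY.le_level hy hy1).trans (hY.cone x x' _ _ (le_of_eq ?_)))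
    field_simp
    ring
  have h1 := key x x'
  have h2 := key x' x
  rw [abs_sub_comm x' x] at h2
  exact abs_le.2 ⟨by linarith, by linarith⟩

end level

open Classical in
/-- The admissible function with a given profile. -/
noncomputable def profileHeight (hb : squareBoundary → ℝ) (Y : ℝ × ℝ → ℝ)
    (p : unitInterval × unitInterval) : ℝ :=
  if p.2 = 0 then hb (bottomPt p.1)
  else if p.2 = 1 then hb (topPt p.1)
  else level Y p.1 p.2 - p.2

theorem unitInterval_cases (y : unitInterval) : y = 0 ∨ y = 1 ∨ (0 < (y : ℝ) ∧ (y : ℝ) < 1) := by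
  by_cases h0 : y = 0
  · exact Or.inl h0
  by_cases h1 : y = 1
  · exact Or.inr (Or.inl h1)
  · exact Or.inr (Or.inr ⟨lt_of_le_of_ne y.2.1 fun h => h0 (Subtype.ext h.symm),
      lt_of_le_of_ne y.2.2 fun h => h1 (Subtype.ext h)⟩)

theorem profileHeight_zero (hb : squareBoundary → ℝ) (Y : ℝ × ℝ → ℝ) (x : unitInterval) :
    profileHeight hb Y (x, 0) = hb (bottomPt x) := by simp [profileHeight]

theorem profileHeight_one (hb : squareBoundary → ℝ) (Y : ℝ × ℝ → ℝ) (x : unitInterval) :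
    profileHeight hb Y (x, 1) = hb (topPt x) := by simp [profileHeight]

theorem profileHeight_of_mem (hb : squareBoundary → ℝ) (Y : ℝ × ℝ → ℝ) (x : unitInterval)
    {y : unitInterval} (h0 : 0 < (y : ℝ)) (h1 : (y : ℝ) < 1) :
    profileHeight hb Y (x, y) = level Y x y - y := by
  have h0' : y ≠ 0 := fun h => by simp [h] at h0
  have h1' : y ≠ 1 := fun h => by simp [h] at h1
  simp [profileHeight, h0', h1']

theorem profileHeight_bounds {hb : squareBoundary → ℝ} (hhb : IsBoundaryCondition hb)
    {Y : ℝ × ℝ → ℝ} (hY : IsProfile (botFun hb) (topFun hb) Y) (x y : unitInterval) :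
    hb (bottomPt x) ≤ profileHeight hb Y (x, y) ∧ profileHeight hb Y (x, y) ≤ hb (topPt x) := by
  rcases unitInterval_cases y with rfl | rfl | ⟨h0, h1⟩
  · rw [profileHeight_zero]
    exact ⟨le_rfl, hhb.bottom_le_top x⟩
  · rw [profileHeight_one]
    exact ⟨hhb.bottom_le_top x, le_rfl⟩
  · rw [profileHeight_of_mem hb Y x h0 h1]
    have e1 := hY.add_le_level (x := x) h0 h1.le
    have e2 := hY.level_le_add (x := x) h0 h1.le
    rw [botFun, clampI_coe] at e1
    rw [topFun, clampI_coe] at e2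
    exact ⟨by linarith, by linarith⟩

theorem profileHeight_mem {hb : squareBoundary → ℝ} (hhb : IsBoundaryCondition hb)
    {Y : ℝ × ℝ → ℝ} (hY : IsProfile (botFun hb) (topFun hb) Y) :
    profileHeight hb Y ∈ admissible hb where
  lipschitz y := by
    rcases unitInterval_cases y with rfl | rfl | ⟨h0, h1⟩
    · simpa only [profileHeight_zero] using hhb.bottom_lipschitz
    · simpa only [profileHeight_one] using hhb.top_lipschitz
    · refine lipschitz_of_abs_sub_le fun x x' => ?_
      rw [profileHeight_of_mem hb Y x h0 h1, profileHeight_of_mem hb Y x' h0 h1,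
        sub_sub_sub_cancel_right]
      exact hY.level_lipschitz h0 h1.le x'
  mono x := by
    intro y y' hyy
    have hyy' : (y : ℝ) ≤ y' := hyy
    change profileHeight hb Y (x, y) ≤ profileHeight hb Y (x, y')
    rcases unitInterval_cases y with rfl | rfl | ⟨h0, h1⟩
    · rw [profileHeight_zero]
      exact (profileHeight_bounds hhb hY x y').1
    · rw [le_antisymm unitInterval.le_one' hyy]
    · rcases unitInterval_cases y' with rfl | rfl | ⟨h0', h1'⟩
      · rw [Icc.coe_zero] at hyy'
        linarith
      · rw [profileHeight_one]
        exact (profileHeight_bounds hhb hY x y).2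
      · rw [profileHeight_of_mem hb Y x h0 h1, profileHeight_of_mem hb Y x h0' h1']
        linarith [hY.level_add_le (x := x) h0 hyy' h1'.le]
  boundary := by
    have side : ∀ x y : unitInterval, ∀ C : ℝ, hb (bottomPt x) = C → hb (topPt x) = C →
        profileHeight hb Y (x, y) = C := fun x y C h1 h2 => by
      have h3 := profileHeight_bounds hhb hY x y
      exact le_antisymm (h3.2.trans h2.le) (h1.ge.trans h3.1)
    obtain ⟨C₀, hC₀⟩ := hhb.left_const
    obtain ⟨C₁, hC₁⟩ := hhb.right_const
    rintro ⟨⟨x, y⟩, h⟩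
    rcases h with h | h | h | h
    · obtain rfl : x = 0 := h
      exact (side 0 y C₀ (hC₀ 0) (hC₀ 1)).trans (hC₀ y).symm
    · obtain rfl : x = 1 := h
      exact (side 1 y C₁ (hC₁ 0) (hC₁ 1)).trans (hC₁ y).symm
    · obtain rfl : y = 0 := h
      exact profileHeight_zero hb Y x
    · obtain rfl : y = 1 := h
      exact profileHeight_one hb Y x

/-- Both passages are generalized inverses of each other. Equality is limited to `x` in `[0, 1]`,
because `heightProfile` depends on `x` only through `clampI x` and `Y` need not. -/
theorem heightProfile_profileHeight {hb : squareBoundary → ℝ} {Y : ℝ × ℝ → ℝ}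
    (hY : IsProfile (botFun hb) (topFun hb) Y) {x : ℝ} (hx : x ∈ Icc (0 : ℝ) 1) (w : ℝ) :
    heightProfile (profileHeight hb Y) (x, w) = Y (x, w) := by
  have hs := sqrt_two_pos
  have ew : √2 * w / √2 = w := by field_simp
  have hx' : ((clampI x : unitInterval) : ℝ) = x := by rw [clampI_of_mem hx]
  have hv : Y (x, w) ∈ Icc (0 : ℝ) 1 := ⟨hY.nonneg _, hY.le_one _⟩
  have : sSup {y : unitInterval | (y : ℝ) + profileHeight hb Y (clampI x, y) ≤ √2 * w} =
      ⟨Y (x, w), hv⟩ := by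
    refine sSup_eq_of_forall (f := fun y => profileHeight hb Y (clampI x, y))
      (fun y hy => ?_) fun y hy => ?_
    · have hy' : (y : ℝ) < Y (x, w) := hy
      rcases unitInterval_cases y with rfl | rfl | ⟨h0, h1⟩
      · rw [profileHeight_zero, Icc.coe_zero, zero_add]
        by_contra hcon
        rw [hY.bot x w (not_le.1 hcon).le] at hy'
        exact lt_irrefl _ hy'
      · rw [Icc.coe_one] at hy'
        linarith [hv.2]
      · rw [profileHeight_of_mem hb Y _ h0 h1, add_sub_cancel, hx', hY.level_le_iff h0 h1.le, ew]
        exact hy'.le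
    · have hy' : Y (x, w) < (y : ℝ) := hy
      rcases unitInterval_cases y with rfl | rfl | ⟨h0, h1⟩
      · rw [Icc.coe_zero] at hy'
        linarith [hv.1]
      · rw [profileHeight_one, Icc.coe_one]
        by_contra hcon
        rw [hY.top x w (not_lt.1 hcon)] at hy'
        exact lt_irrefl _ hy'
      · rw [profileHeight_of_mem hb Y _ h0 h1, add_sub_cancel, hx', ← not_le,
          hY.level_le_iff h0 h1.le, ew]
        exact not_le.2 hy'
  simp only [heightProfile, this]

theorem le_of_heightProfile_eq {hb : squareBoundary → ℝ} (hhb : IsBoundaryCondition hb)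
    {h h' : unitInterval × unitInterval → ℝ} (hh : h ∈ admissible hb) (hh' : h' ∈ admissible hb)
    (hf : totalCost (botFun hb) (topFun hb) (heightProfile h) ≠ ⊤)
    (he : ∀ x ∈ Icc (0 : ℝ) 1, ∀ w, heightProfile h (x, w) = heightProfile h' (x, w))
    (p : unitInterval × unitInterval) : h p ≤ h' p := by
  obtain ⟨x, y⟩ := p
  have hs := sqrt_two_pos
  by_contra hcon
  have hcon := not_le.1 hcon
  have e : ∀ a : ℝ, √2 * (a / √2) = a := fun a => by field_simp
  -- For such `c` the profile of `h` is at most `y` and that of `h'` at least `y`. Their common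
  -- value is therefore `y` on a whole interval, a flat piece excluded by finite cost.
  have key : ∀ c, y + h' (x, y) < c → c < y + h (x, y) → heightProfile h (x, c / √2) = y := by
    intro c h1 h2
    refine le_antisymm ?_ ?_
    · simp only [heightProfile, clampI_coe, e]
      refine Subtype.coe_le_coe.2 (not_lt.1 fun hlt => ?_)
      have := le_of_lt_sSup (hh.mono x) hlt
      linarith
    · rw [he x x.2]
      simp only [heightProfile, clampI_coe, e]
      exact Subtype.coe_le_coe.2 (le_sSup h1.le)
  obtain ⟨c₁, h1, h1'⟩ := exists_between (show y + h' (x, y) < y + h (x, y) by linarith)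
  obtain ⟨c₂, h2, h2'⟩ := exists_between h1'
  have g1 : h' (x, 0) ≤ h' (x, y) := hh'.mono x unitInterval.nonneg'
  have g2 : h (x, y) ≤ h (x, 1) := hh.mono x unitInterval.le_one'
  rw [hh'.bot_eq] at g1
  rw [hh.top_eq] at g2
  have hlt := hh.isProfile.lt_of_totalCost_ne_top hhb.isBoundaryPair hf (x := x) (w₁ := c₁ / √2)
    (w₂ := c₂ / √2) x.2 (by rw [e, botFun, clampI_coe]; linarith [y.2.1])
    (by rw [e, topFun, clampI_coe]; linarith [y.2.2]) (by gcongr)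
  rw [key c₁ h1 h1', key c₂ (h1.trans h2) h2'] at hlt
  exact lt_irrefl _ hlt

/-! ### A profile of finite cost -/

/-- There is a curve between the two boundary curves whose slope is quantitatively less than `1/2`
wherever the boundary curves differ. -/
theorem IsBoundaryPair.exists_middle {b t : ℝ → ℝ} (h : IsBoundaryPair b t)
    (hg : ∀ x, t x - b x ≤ 1) :
    ∃ m : ℝ → ℝ, (∀ x x', |m x - m x'| ≤ |x - x'| / 2) ∧
      (∀ x ∈ Icc (0 : ℝ) 1, b x ≤ m x ∧ m x ≤ t x) ∧
      ∀ x, |deriv m x| ≤ 1 / 2 - (t x - b x) / 2 := by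
  have hbc := h.continuous_bot
  have htc := h.continuous_top
  set s : ℝ → ℝ := fun u => 1 / 2 - (t u - b u) / 2 with hs
  have hsc : Continuous s := by fun_prop
  have hs0 : ∀ u, 0 ≤ s u := fun u => by simp only [hs]; linarith [hg u]
  have hs1 : ∀ u, s u ≤ 1 / 2 := fun u => by simp only [hs]; linarith [h.le u]
  set V : ℝ → ℝ := fun x => ∫ u in (0 : ℝ)..x, s u with hV
  have hVsub : ∀ x x', V x' - V x = ∫ u in x..x', s u := fun x x' =>
    intervalIntegral.integral_interval_sub_left (hsc.intervalIntegrable _ _)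
      (hsc.intervalIntegrable _ _)
  have hVd : ∀ x, HasDerivAt V (s x) x := fun x =>
    intervalIntegral.integral_hasDerivAt_right (hsc.intervalIntegrable _ _)
      hsc.stronglyMeasurable.stronglyMeasurableAtFilter hsc.continuousAt
  have hVlip : ∀ x x', |V x - V x'| ≤ |x - x'| / 2 := fun x x' => by
    rw [hVsub x' x, ← Real.norm_eq_abs]
    refine (intervalIntegral.norm_integral_le_of_norm_le_const (C := 1 / 2) fun u _ => ?_).trans
      (le_of_eq (by ring))
    rw [Real.norm_of_nonneg (hs0 u)]
    exact hs1 u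
  have hVge : ∀ x x' R, x ≤ x' → (∀ u ∈ Icc x x', t u - b u ≤ R) →
      (x' - x) * (1 / 2 - R / 2) ≤ V x' - V x := fun x x' R hxx hR => by
    rw [hVsub, ← smul_eq_mul, ← intervalIntegral.integral_const]
    refine intervalIntegral.integral_mono_on hxx intervalIntegrable_const
      (hsc.intervalIntegrable _ _) fun u hu => ?_
    simp only [hs]
    linarith [hR u hu]
  -- Let `V` be a primitive of the allowed slope `s`. The supremum of `F x` is the least function
  -- above `b` that is 1-Lipschitz for the pseudometric `|V x' - V x|`.
  set F : ℝ → unitInterval → ℝ := fun x x' => b x' - |V x' - V x| with hF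
  have hbdd : ∀ x, BddAbove (range (F x)) := fun x => by
    refine ⟨b 0 + 1 / 2, ?_⟩
    rintro _ ⟨x', rfl⟩
    have h1 := abs_le.1 (h.lip_bot x' 0)
    rw [sub_zero, abs_of_nonneg x'.2.1] at h1
    have h2 := abs_nonneg (V x' - V x)
    simp only [hF]
    linarith [x'.2.2]
  set m : ℝ → ℝ := fun x => ⨆ x', F x x' with hm
  have hmV : ∀ x x', m x ≤ m x' + |V x - V x'| := fun x x' => by
    refine ciSup_le fun u => ?_
    have h1 := le_ciSup (hbdd x') u
    have h2 := abs_sub_le (V u) (V x) (V x')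
    simp only [hF, hm] at h1 ⊢
    linarith
  have hmV' : ∀ x x', |m x - m x'| ≤ |V x - V x'| := fun x x' => by
    have h1 := hmV x x'
    have h2 := hmV x' x
    rw [abs_sub_comm (V x') (V x)] at h2
    exact abs_le.2 ⟨by linarith, by linarith⟩
  refine ⟨m, fun x x' => (hmV' x x').trans (hVlip x x'), fun x hx => ⟨?_, ?_⟩, fun x => ?_⟩
  · have h1 := le_ciSup (hbdd x) ⟨x, hx⟩
    simpa [hF] using h1
  · refine ciSup_le fun x' => ?_
    obtain ⟨h0', h1'⟩ := x'.2
    obtain ⟨h0, h1⟩ := hx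
    simp only [hF]
    -- `R` bounds the gap `t - b` between `x` and `x'`, so `V` varies there by at least `|x - x'| (1
    -- - R) / 2`. This suffices for `F x x' ≤ t x` since `R ≥ 0` and `|x - x'| ≤ 1`.
    set R := t x - b x' + |x - x'| / 2 with hR
    have hR0 : 0 ≤ R := by
      have := (abs_le.1 (h.lip_bot x x')).1
      linarith [h.le x]
    rcases le_total x x' with hxx | hxx
    · have e : |x - x'| = x' - x := by rw [abs_sub_comm, abs_of_nonneg (by linarith)]
      have k1 := hVge x x' R hxx fun u hu => by
        have a1 := (abs_le.1 (h.lip_bot x' u)).2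
        have a2 := (abs_le.1 (h.lip_top u x)).2
        rw [abs_of_nonneg (by linarith [hu.2])] at a1
        rw [abs_of_nonneg (by linarith [hu.1])] at a2
        rw [hR, e]
        linarith
      have k2 := le_abs_self (V x' - V x)
      rw [e] at hR
      nlinarith
    · have e : |x - x'| = x - x' := abs_of_nonneg (by linarith)
      have k1 := hVge x' x R hxx fun u hu => by
        have a1 := (abs_le.1 (h.lip_bot u x')).1
        have a2 := (abs_le.1 (h.lip_top x u)).1
        rw [abs_of_nonneg (by linarith [hu.1])] at a1
        rw [abs_of_nonneg (by linarith [hu.2])] at a2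
        rw [hR, e]
        linarith
      have k2 := neg_abs_le (V x' - V x)
      rw [e] at hR
      nlinarith
  · by_cases hd : DifferentiableAt ℝ m x
    · have h1 := hd.hasDerivAt.tendsto_slope.norm
      have h2 := (hVd x).tendsto_slope.norm
      rw [Real.norm_of_nonneg (hs0 x)] at h2
      refine le_of_tendsto_of_tendsto' h1 h2 fun y => ?_
      rw [slope_def_field, slope_def_field, norm_div, norm_div]
      exact div_le_div_of_nonneg_right (hmV' y x) (norm_nonneg _)
    · rw [deriv_zero_of_not_differentiableAt hd, abs_zero]
      exact hs0 x

/-- The margin `g a / 9` below `C` contributes `-T log g - T log a`. The bound `T ≤ 3 g` absorbs the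
first term, since `-g log g` is bounded, so no singularity remains where the boundary curves meet;
only the integrable `log a` is left. -/
theorem cost_le_of_margin {p q g a : ℝ} (h : 2 * √2 * |p| ≤ q) (h' : q ≤ √2) (hg1 : g ≤ 1)
    (ha : 0 < a) (hT : √2 - q ≤ 3 * g) (hC : g * a / 9 ≤ q - 2 * √2 * |p|) :
    cost p q ≤ 100 + 2 * ‖Real.log a‖ₑ := by
  have hs := sqrt_two_lt_two
  have hs0 := sqrt_two_pos
  have hpi := Real.pi_lt_four
  have hpi0 := Real.pi_pos
  rcases (sub_nonneg.2 h').eq_or_lt with hT0 | hT0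
  · have : cost p q = 1 := by simp [cost, costFun, ← hT0]
    rw [this]
    exact le_trans (by norm_num) le_self_add
  have hg : 0 < g := by linarith
  have hC0 : 0 < perspCos p q := by
    have : 0 < g * a / 9 := by positivity
    linarith [sub_le_perspCos h]
  have hcost : cost p q = ENNReal.ofReal (costReal (perspCos p q) (√2 - q)) := by
    simp [cost, costFun, hT0.ne', hC0.ne']
  have e1 : Real.log (perspCos p q / (Real.pi * (√2 - q))) =
      Real.log (perspCos p q) - Real.log (Real.pi * (√2 - q)) :=
    Real.log_div hC0.ne' (by positivity)
  have e2 : Real.log (g * a / 9) ≤ Real.log (perspCos p q) :=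
    Real.log_le_log (by positivity) (hC.trans (sub_le_perspCos h))
  have e3 : Real.log (g * a / 9) = Real.log g + Real.log a - Real.log 9 := by
    rw [Real.log_div (by positivity) (by norm_num), Real.log_mul hg.ne' ha.ne']
  have e4 : Real.log 9 ≤ 9 - 1 := Real.log_le_sub_one_of_pos (by norm_num)
  have e5 : Real.log (Real.pi * (√2 - q)) ≤ Real.pi * (√2 - q) - 1 :=
    Real.log_le_sub_one_of_pos (by positivity)
  have e6 : -(g * Real.log g) ≤ 1 := by
    have h1 := Real.log_le_sub_one_of_pos (inv_pos.2 hg)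
    rw [Real.log_inv] at h1
    have h2 := mul_le_mul_of_nonneg_left h1 hg.le
    rw [mul_sub, mul_inv_cancel₀ hg.ne'] at h2
    linarith
  have e7 : Real.log g ≤ 0 := Real.log_nonpos hg.le hg1
  have e8 := neg_abs_le (Real.log a)
  have e9 := abs_nonneg (Real.log a)
  have q0 := nonneg_of_cone h
  set T := √2 - q with hTdef
  have hT2 : T ≤ 2 := by linarith
  have f1 : T * -Real.log g ≤ 3 := by nlinarith
  have f2 : T * -Real.log a ≤ 2 * |Real.log a| := by nlinarith
  have f3 : T * Real.log (Real.pi * T) ≤ 14 := by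
    have : Real.pi * T ≤ 8 := by nlinarith
    nlinarith
  have hreal : costReal (perspCos p q) T ≤ 100 + 2 * |Real.log a| := by
    rw [costReal, e1]
    have f4 : T * (Real.log g + Real.log a - 8) ≤ T * Real.log (perspCos p q) :=
      mul_le_mul_of_nonneg_left (by linarith) hT0.le
    nlinarith
  rw [hcost]
  refine (ENNReal.ofReal_le_ofReal hreal).trans (le_of_eq ?_)
  rw [ENNReal.ofReal_add (by norm_num) (by positivity), ENNReal.ofReal_mul (by norm_num),
    ← Real.norm_eq_abs, ofReal_norm]
  norm_num

/-- On the lower half, `θ` is the height `y`, `U = m - b`, `g = t - b`, and `a = θ (1 + 2 U) ≤ 3 θ`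
is the distance to the lower curve. The mix of `β = b'` and `μ = m'` is the horizontal slope of the
function at height `θ`; the deficit `g / 2` of `μ` keeps it `θ g` away from `1/2`. -/
theorem cost_le_of_mix {p q g a β μ θ U : ℝ} (h : 2 * √2 * |p| ≤ q) (h' : q ≤ √2)
    (hU0 : 0 ≤ U) (hUg : U ≤ g) (hg1 : g ≤ 1) (ha : 0 < a) (hθ : a ≤ 3 * θ) (hθ' : θ ≤ 1 / 2)
    (hβ : |β| ≤ 1 / 2) (hμ : |μ| ≤ 1 / 2 - g / 2) (hq : q = √2 / (1 + 2 * U))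
    (hp : |p| = |(1 - 2 * θ) * β + 2 * θ * μ| / (1 + 2 * U)) :
    cost p q ≤ 100 + 2 * ‖Real.log a‖ₑ := by
  have hs := sqrt_two_lt_two
  have hs0 := sqrt_two_pos
  have h22 := sqrt_two_mul_self
  have hs1 : 1 ≤ √2 := by nlinarith
  have hD : 0 < 1 + 2 * U := by linarith
  refine cost_le_of_margin h h' hg1 ha ?_ ?_
  · have e : √2 - q = √2 * (2 * U) / (1 + 2 * U) := by rw [hq]; field_simp; ring
    rw [e, div_le_iff₀ hD]
    have : √2 * (2 * U) ≤ 3 * U := by nlinarith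
    nlinarith
  · have e1 : |(1 - 2 * θ) * β + 2 * θ * μ| ≤ 1 / 2 - θ * g := by
      refine (abs_add_le _ _).trans ?_
      rw [abs_mul, abs_mul, abs_of_nonneg (by linarith : 0 ≤ 1 - 2 * θ),
        abs_of_nonneg (by linarith : 0 ≤ 2 * θ)]
      nlinarith
    have e2 : q - 2 * √2 * |p| = √2 * (1 - 2 * |(1 - 2 * θ) * β + 2 * θ * μ|) / (1 + 2 * U) := by
      rw [hq, hp]; field_simp
    rw [e2, le_div_iff₀ hD]
    have hg0 := hU0.trans hUg
    have e3 : g * a / 9 * (1 + 2 * U) ≤ g * θ := by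
      have : a * (1 + 2 * U) ≤ 9 * θ := by nlinarith
      nlinarith
    have e4 : 2 * (θ * g) ≤ 1 - 2 * |(1 - 2 * θ) * β + 2 * θ * μ| := by linarith
    have e5 : 0 ≤ θ * g := by have : 0 ≤ θ := by linarith
                              positivity
    nlinarith

/-- The piecewise linear interpolation through three curves. -/
noncomputable def broken (b m t : ℝ → ℝ) (p : unitInterval × unitInterval) : ℝ :=
  b p.1 + min (2 * (p.2 : ℝ)) 1 * (m p.1 - b p.1) + max (2 * (p.2 : ℝ) - 1) 0 * (t p.1 - m p.1)

theorem heightProfile_eq_of_eq {hb : squareBoundary → ℝ} {h : unitInterval × unitInterval → ℝ}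
    (hh : h ∈ admissible hb) {x w : ℝ} {v : unitInterval}
    (hv : (v : ℝ) + h (clampI x, v) = √2 * w) : heightProfile h (x, w) = v := by
  have : sSup {y : unitInterval | (y : ℝ) + h (clampI x, y) ≤ √2 * w} = v := by
    refine sSup_eq_of_forall (f := fun y => h (clampI x, y)) (fun y hy => ?_) fun y hy => ?_
    · have h1 : h (clampI x, y) ≤ h (clampI x, v) := hh.mono _ hy.le
      have h2 : (y : ℝ) < v := hy
      linarith
    · have h1 : h (clampI x, v) ≤ h (clampI x, y) := hh.mono _ hy.le
      have h2 : (v : ℝ) < y := hy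
      linarith
  simp only [heightProfile, this]

theorem broken_mem {hb : squareBoundary → ℝ} (hhb : IsBoundaryCondition hb) {m : ℝ → ℝ}
    (hm : ∀ x x', |m x - m x'| ≤ |x - x'| / 2)
    (hbm : ∀ x ∈ Icc (0 : ℝ) 1, botFun hb x ≤ m x ∧ m x ≤ topFun hb x) :
    broken (botFun hb) m (topFun hb) ∈ admissible hb where
  lipschitz y := by
    refine lipschitz_of_abs_sub_le fun x x' => ?_
    have h1 := abs_le.1 (hhb.isBoundaryPair.lip_bot x x')
    have h2 := abs_le.1 (hm x x')
    have h3 := abs_le.1 (hhb.isBoundaryPair.lip_top x x')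
    simp only [broken]
    have hy0 := y.2.1
    have hy1 := y.2.2
    set d := |(x : ℝ) - x'| / 2
    have hα : min (2 * (y : ℝ)) 1 ≤ 1 := min_le_right _ _
    have hβ : 0 ≤ max (2 * (y : ℝ) - 1) 0 := le_max_right _ _
    have hαβ : max (2 * (y : ℝ) - 1) 0 ≤ min (2 * (y : ℝ)) 1 :=
      max_le (le_min (by linarith) (by linarith)) (le_min (by linarith) zero_le_one)
    -- At fixed `y` the three curves enter with nonnegative weights of sum 1, which preserves the
    -- Lipschitz constant.
    refine abs_le.2 ⟨?_, ?_⟩ <;> nlinarith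
  mono x := by
    intro y y' hyy
    have hyy' : (y : ℝ) ≤ y' := hyy
    obtain ⟨h1, h2⟩ := hbm x x.2
    simp only [broken]
    have h3 : min (2 * (y : ℝ)) 1 ≤ min (2 * (y' : ℝ)) 1 := min_le_min_right _ (by linarith)
    have h4 : max (2 * (y : ℝ) - 1) 0 ≤ max (2 * (y' : ℝ) - 1) 0 := max_le_max_right _ (by linarith)
    nlinarith
  boundary := by
    have hbp := hhb.isBoundaryPair
    have side : ∀ x y : unitInterval, botFun hb x = topFun hb x →
        broken (botFun hb) m (topFun hb) (x, y) = botFun hb x := fun x y h => by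
      obtain ⟨h1, h2⟩ := hbm x x.2
      have h3 : m x = botFun hb x := le_antisymm (h2.trans h.ge) h1
      simp [broken, h3, ← h]
    obtain ⟨C₀, hC₀⟩ := hhb.left_const
    obtain ⟨C₁, hC₁⟩ := hhb.right_const
    rintro ⟨⟨x, y⟩, h⟩
    rcases h with h | h | h | h
    · obtain rfl : x = 0 := h
      refine (side 0 y hbp.left).trans ?_
      rw [botFun, clampI_coe]
      exact (hC₀ 0).trans (hC₀ y).symm
    · obtain rfl : x = 1 := h
      refine (side 1 y hbp.right).trans ?_
      rw [botFun, clampI_coe]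
      exact (hC₁ 0).trans (hC₁ y).symm
    · obtain rfl : y = 0 := h
      simp only [broken, botFun, clampI_coe]
      norm_num
      rfl
    · obtain rfl : y = 1 := h
      simp only [broken, topFun, clampI_coe]
      norm_num
      rfl

theorem gradX_congr {Y Z : ℝ × ℝ → ℝ} {z : ℝ × ℝ} (h : Y =ᶠ[𝓝 z] Z) : gradX Y z = gradX Z z := by
  have hc : Continuous fun x : ℝ => (x, z.2) := by fun_prop
  have h1 : (fun x => Y (x, z.2)) =ᶠ[𝓝 z.1] fun x => Z (x, z.2) := (hc.tendsto z.1).eventually h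
  exact h1.deriv_eq

theorem gradY_congr {Y Z : ℝ × ℝ → ℝ} {z : ℝ × ℝ} (h : Y =ᶠ[𝓝 z] Z) : gradY Y z = gradY Z z := by
  have hc : Continuous fun w : ℝ => (z.1, w) := by fun_prop
  have h1 : (fun w => Y (z.1, w)) =ᶠ[𝓝 z.2] fun w => Z (z.1, w) := (hc.tendsto z.2).eventually h
  exact h1.deriv_eq

theorem abs_gradX_div {B m : ℝ → ℝ} {z : ℝ × ℝ} (hB : DifferentiableAt ℝ B z.1)
    (hm : DifferentiableAt ℝ m z.1) {c : ℝ} (hD : 0 < 1 + 2 * (m z.1 - B z.1)) :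
    |deriv (fun x => (c - B x) / (1 + 2 * (m x - B x))) z.1| =
      |(1 - 2 * ((c - B z.1) / (1 + 2 * (m z.1 - B z.1)))) * deriv B z.1 +
        2 * ((c - B z.1) / (1 + 2 * (m z.1 - B z.1))) * deriv m z.1| /
        (1 + 2 * (m z.1 - B z.1)) := by
  have h1 := (hB.hasDerivAt.const_sub c).div
    (((hm.hasDerivAt.sub hB.hasDerivAt).const_mul 2).const_add 1) hD.ne'
  have e := h1.deriv
  simp only [Pi.div_def, Pi.sub_apply] at e
  rw [e, ← abs_of_pos hD, ← abs_div, abs_of_pos hD, ← abs_neg]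
  congr 1
  field_simp
  ring

section broken

variable {hb : squareBoundary → ℝ} {m : ℝ → ℝ}

theorem heightProfile_broken_lower (hhb : IsBoundaryCondition hb)
    (hm : ∀ x x', |m x - m x'| ≤ |x - x'| / 2)
    (hbm : ∀ x ∈ Icc (0 : ℝ) 1, botFun hb x ≤ m x ∧ m x ≤ topFun hb x) {x w : ℝ}
    (hx : x ∈ Icc (0 : ℝ) 1) (h1 : botFun hb x ≤ √2 * w) (h2 : √2 * w ≤ m x + 1 / 2) :
    heightProfile (broken (botFun hb) m (topFun hb)) (x, w) =
      (√2 * w - botFun hb x) / (1 + 2 * (m x - botFun hb x)) := by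
  have hD : 0 < 1 + 2 * (m x - botFun hb x) := by linarith [(hbm x hx).1]
  set v := (√2 * w - botFun hb x) / (1 + 2 * (m x - botFun hb x)) with hv
  have hv0 : 0 ≤ v := div_nonneg (by linarith) hD.le
  have hv1 : v ≤ 1 / 2 := by rw [hv, div_le_iff₀ hD]; linarith
  have hve : v * (1 + 2 * (m x - botFun hb x)) = √2 * w - botFun hb x := div_mul_cancel₀ _ hD.ne'
  refine heightProfile_eq_of_eq (broken_mem hhb hm hbm) (v := ⟨v, hv0, by linarith⟩) ?_
  simp only [broken, clampI_of_mem hx]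
  rw [min_eq_left (by linarith), max_eq_right (by linarith)]
  linarith

/-- The formula is the lower one under the symmetry `y ↦ 1 - y`, `h ↦ -h`, with `-t` and `-m` in
place of `b` and `m`. The negations are kept so that `abs_gradX_div` and `cost_le_of_mix` apply to
both halves. -/
theorem heightProfile_broken_upper (hhb : IsBoundaryCondition hb)
    (hm : ∀ x x', |m x - m x'| ≤ |x - x'| / 2)
    (hbm : ∀ x ∈ Icc (0 : ℝ) 1, botFun hb x ≤ m x ∧ m x ≤ topFun hb x) {x w : ℝ}
    (hx : x ∈ Icc (0 : ℝ) 1) (h1 : √2 * w ≤ 1 + topFun hb x) (h2 : m x + 1 / 2 ≤ √2 * w) :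
    heightProfile (broken (botFun hb) m (topFun hb)) (x, w) =
      1 - (1 - √2 * w - (-topFun hb x)) / (1 + 2 * (-m x - (-topFun hb x))) := by
  have hD : 0 < 1 + 2 * (-m x - (-topFun hb x)) := by linarith [(hbm x hx).2]
  set v := (1 - √2 * w - (-topFun hb x)) / (1 + 2 * (-m x - (-topFun hb x))) with hv
  have hv0 : 0 ≤ v := div_nonneg (by linarith) hD.le
  have hv1 : v ≤ 1 / 2 := by rw [hv, div_le_iff₀ hD]; linarith
  have hve : v * (1 + 2 * (-m x - (-topFun hb x))) = 1 - √2 * w - (-topFun hb x) :=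
    div_mul_cancel₀ _ hD.ne'
  refine heightProfile_eq_of_eq (broken_mem hhb hm hbm) (v := ⟨1 - v, by linarith, by linarith⟩) ?_
  simp only [broken, clampI_of_mem hx]
  rw [min_eq_right (by linarith), max_eq_left (by linarith)]
  linarith

theorem abs_deriv_le_half {f : ℝ → ℝ} (hf : ∀ x x', |f x - f x'| ≤ |x - x'| / 2) (x : ℝ) :
    |deriv f x| ≤ 1 / 2 := by
  have := norm_deriv_le_of_lipschitz (lipschitzWith_half hf) (x₀ := x)
  rw [Real.norm_eq_abs] at this
  push_cast at this
  exact this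

theorem cost_broken_lower (hhb : IsBoundaryCondition hb)
    (hm : ∀ x x', |m x - m x'| ≤ |x - x'| / 2)
    (hbm : ∀ x ∈ Icc (0 : ℝ) 1, botFun hb x ≤ m x ∧ m x ≤ topFun hb x)
    (hm' : ∀ x, |deriv m x| ≤ 1 / 2 - (topFun hb x - botFun hb x) / 2)
    (hg : ∀ x, topFun hb x - botFun hb x ≤ 1) {z : ℝ × ℝ} (hx : z.1 ∈ Ioo (0 : ℝ) 1)
    (h1 : botFun hb z.1 < √2 * z.2) (h2 : √2 * z.2 < m z.1 + 1 / 2)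
    (hdb : DifferentiableAt ℝ (botFun hb) z.1) (hdm : DifferentiableAt ℝ m z.1)
    (hdY : DifferentiableAt ℝ (heightProfile (broken (botFun hb) m (topFun hb))) z) :
    cost (gradX (heightProfile (broken (botFun hb) m (topFun hb))) z)
      (gradY (heightProfile (broken (botFun hb) m (topFun hb))) z) ≤
      100 + 2 * ‖Real.log (√2 * z.2 - botFun hb z.1)‖ₑ := by
  have hbp := hhb.isBoundaryPair
  have hbc := hbp.continuous_bot
  have hmc := (lipschitzWith_half hm).continuous
  obtain ⟨hU, hU'⟩ := hbm z.1 (Ioo_subset_Icc_self hx)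
  have hD : 0 < 1 + 2 * (m z.1 - botFun hb z.1) := by linarith
  have hgz := hg z.1
  have hev : heightProfile (broken (botFun hb) m (topFun hb)) =ᶠ[𝓝 z]
      fun z => (√2 * z.2 - botFun hb z.1) / (1 + 2 * (m z.1 - botFun hb z.1)) := by
    have o1 : ∀ᶠ y in 𝓝 z, y.1 ∈ Ioo (0 : ℝ) 1 :=
      (isOpen_Ioo.preimage continuous_fst).mem_nhds hx
    have o2 : ∀ᶠ y in 𝓝 z, botFun hb y.1 < √2 * y.2 :=
      (isOpen_lt (by fun_prop) (by fun_prop)).mem_nhds h1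
    have o3 : ∀ᶠ y in 𝓝 z, √2 * y.2 < m y.1 + 1 / 2 :=
      (isOpen_lt (by fun_prop) (by fun_prop)).mem_nhds h2
    filter_upwards [o1, o2, o3] with y g1 g2 g3
    exact heightProfile_broken_lower hhb hm hbm (Ioo_subset_Icc_self g1) g2.le g3.le
  obtain ⟨s1, s2⟩ := (broken_mem hhb hm hbm).isProfile.slope_mem hdY
  have hgy : gradY (heightProfile (broken (botFun hb) m (topFun hb))) z =
      √2 / (1 + 2 * (m z.1 - botFun hb z.1)) := by
    rw [gradY_congr hev]
    have h1 := (((hasDerivAt_id z.2).const_mul √2).sub_const (botFun hb z.1)).div_const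
      (1 + 2 * (m z.1 - botFun hb z.1))
    rw [mul_one] at h1
    exact h1.deriv
  refine cost_le_of_mix s1 s2 (g := topFun hb z.1 - botFun hb z.1) (U := m z.1 - botFun hb z.1)
    (θ := (√2 * z.2 - botFun hb z.1) / (1 + 2 * (m z.1 - botFun hb z.1)))
    (by linarith) (by linarith) hgz (by linarith) ?_ ?_
    (abs_deriv_le_half hbp.lip_bot z.1) (hm' z.1) hgy ?_
  · rw [← mul_div_assoc, le_div_iff₀ hD]
    nlinarith
  · rw [div_le_iff₀ hD]
    linarith
  · rw [gradX_congr hev]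
    exact abs_gradX_div (c := √2 * z.2) hdb hdm hD

theorem cost_broken_upper (hhb : IsBoundaryCondition hb)
    (hm : ∀ x x', |m x - m x'| ≤ |x - x'| / 2)
    (hbm : ∀ x ∈ Icc (0 : ℝ) 1, botFun hb x ≤ m x ∧ m x ≤ topFun hb x)
    (hm' : ∀ x, |deriv m x| ≤ 1 / 2 - (topFun hb x - botFun hb x) / 2)
    (hg : ∀ x, topFun hb x - botFun hb x ≤ 1) {z : ℝ × ℝ} (hx : z.1 ∈ Ioo (0 : ℝ) 1)
    (h1 : √2 * z.2 < 1 + topFun hb z.1) (h2 : m z.1 + 1 / 2 < √2 * z.2)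
    (hdt : DifferentiableAt ℝ (topFun hb) z.1) (hdm : DifferentiableAt ℝ m z.1)
    (hdY : DifferentiableAt ℝ (heightProfile (broken (botFun hb) m (topFun hb))) z) :
    cost (gradX (heightProfile (broken (botFun hb) m (topFun hb))) z)
      (gradY (heightProfile (broken (botFun hb) m (topFun hb))) z) ≤
      100 + 2 * ‖Real.log (1 + topFun hb z.1 - √2 * z.2)‖ₑ := by
  have hbp := hhb.isBoundaryPair
  have htc := hbp.continuous_top
  have hmc := (lipschitzWith_half hm).continuous
  obtain ⟨hU, hU'⟩ := hbm z.1 (Ioo_subset_Icc_self hx)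
  have hD : 0 < 1 + 2 * (-m z.1 - (-topFun hb z.1)) := by linarith
  have hgz := hg z.1
  have hev : heightProfile (broken (botFun hb) m (topFun hb)) =ᶠ[𝓝 z]
      fun z => 1 - (1 - √2 * z.2 - (-topFun hb z.1)) / (1 + 2 * (-m z.1 - (-topFun hb z.1))) := by
    have o1 : ∀ᶠ y in 𝓝 z, y.1 ∈ Ioo (0 : ℝ) 1 :=
      (isOpen_Ioo.preimage continuous_fst).mem_nhds hx
    have o2 : ∀ᶠ y in 𝓝 z, √2 * y.2 < 1 + topFun hb y.1 :=
      (isOpen_lt (by fun_prop) (by fun_prop)).mem_nhds h1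
    have o3 : ∀ᶠ y in 𝓝 z, m y.1 + 1 / 2 < √2 * y.2 :=
      (isOpen_lt (by fun_prop) (by fun_prop)).mem_nhds h2
    filter_upwards [o1, o2, o3] with y g1 g2 g3
    exact heightProfile_broken_upper hhb hm hbm (Ioo_subset_Icc_self g1) g2.le g3.le
  obtain ⟨s1, s2⟩ := (broken_mem hhb hm hbm).isProfile.slope_mem hdY
  have hgy : gradY (heightProfile (broken (botFun hb) m (topFun hb))) z =
      √2 / (1 + 2 * (-m z.1 - (-topFun hb z.1))) := by
    rw [gradY_congr hev]
    have h1 := (((((hasDerivAt_id z.2).const_mul √2).const_sub 1).sub_const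
      (-topFun hb z.1)).div_const (1 + 2 * (-m z.1 - (-topFun hb z.1)))).const_sub 1
    rw [mul_one, neg_div, neg_neg] at h1
    exact h1.deriv
  refine cost_le_of_mix s1 s2 (g := topFun hb z.1 - botFun hb z.1)
    (U := -m z.1 - (-topFun hb z.1)) (β := deriv (fun x => -topFun hb x) z.1)
    (μ := deriv (fun x => -m x) z.1)
    (θ := (1 - √2 * z.2 - (-topFun hb z.1)) / (1 + 2 * (-m z.1 - (-topFun hb z.1))))
    (by linarith) (by linarith) hgz (by linarith) ?_ ?_ ?_ ?_ hgy ?_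
  · rw [← mul_div_assoc, le_div_iff₀ hD]
    nlinarith
  · rw [div_le_iff₀ hD]
    linarith
  · rw [deriv.fun_neg, abs_neg]
    exact abs_deriv_le_half hbp.lip_top z.1
  · rw [deriv.fun_neg, abs_neg]
    exact hm' z.1
  · rw [gradX_congr hev]
    rw [← abs_gradX_div (B := fun x => -topFun hb x) (m := fun x => -m x) hdt.neg hdm.neg hD]
    rw [gradX, deriv_const_sub, abs_neg]

end broken

theorem IsBoundaryPair.topFun_sub_botFun_le {hb : squareBoundary → ℝ}
    (h : IsBoundaryPair (botFun hb) (topFun hb)) (x : ℝ) : topFun hb x - botFun hb x ≤ 1 := by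
  have e1 : botFun hb x = botFun hb (clampI x) := by rw [botFun, botFun, clampI_coe]
  have e2 : topFun hb x = topFun hb (clampI x) := by rw [topFun, topFun, clampI_coe]
  have h1 := abs_le.1 (h.lip_bot (clampI x) 0)
  have h2 := abs_le.1 (h.lip_top (clampI x) 0)
  rw [sub_zero, abs_of_nonneg (clampI x).2.1] at h1 h2
  have h3 := h.left
  rw [e1, e2]
  linarith [(clampI x).2.2]

/-- The range `(0, 2]` suffices because the strip has height at most 2 in the variable `√2 w`: 1
plus a gap of at most 1. -/
theorem lintegral_log_ne_top :
    ∫⁻ w : ℝ, (Ioc (0 : ℝ) 2).indicator (fun a => ‖Real.log a‖ₑ) (√2 * w) ≠ ⊤ := by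
  have hs := sqrt_two_pos
  have hi : IntegrableOn (fun w => Real.log √2 + Real.log w) (Ioc 0 √2) :=
    (intervalIntegrable_iff_integrableOn_Ioc_of_le hs.le).1
      (intervalIntegrable_const.add intervalIntegral.intervalIntegrable_log')
  refine ne_top_of_le_ne_top hi.2.ne ?_
  rw [← lintegral_indicator measurableSet_Ioc]
  refine lintegral_mono fun w => ?_
  by_cases hw : √2 * w ∈ Ioc (0 : ℝ) 2
  · have hw0 : 0 < w := pos_of_mul_pos_right hw.1 hs.le
    have hw1 : w ∈ Ioc 0 √2 := ⟨hw0, by nlinarith [hw.2, sqrt_two_mul_self]⟩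
    rw [indicator_of_mem hw, indicator_of_mem hw1, Real.log_mul hs.ne' hw0.ne']
  · rw [indicator_of_notMem hw]
    exact zero_le

theorem ae_mul_ne {f : ℝ → ℝ} (hf : Continuous f) : ∀ᵐ z : ℝ × ℝ, √2 * z.2 ≠ f z.1 := by
  have hs := sqrt_two_pos
  have hm : MeasurableSet {z : ℝ × ℝ | √2 * z.2 ≠ f z.1} :=
    (isClosed_eq (by fun_prop) (by fun_prop)).measurableSet.compl
  rw [Measure.volume_eq_prod]
  refine (Measure.ae_prod_iff_ae_ae hm).2 (Eventually.of_forall fun x => ?_)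
  have : ∀ᵐ w : ℝ, w ≠ f x / √2 := by simp [ae_iff, measure_singleton]
  filter_upwards [this] with w hw
  rwa [ne_eq, eq_div_iff hs.ne', mul_comm] at hw

theorem exists_totalCost_ne_top {hb : squareBoundary → ℝ} (hhb : IsBoundaryCondition hb) :
    ∃ Y, IsProfile (botFun hb) (topFun hb) Y ∧ totalCost (botFun hb) (topFun hb) Y ≠ ⊤ := by
  have hbp := hhb.isBoundaryPair
  have hs := sqrt_two_pos
  have hbc := hbp.continuous_bot
  have htc := hbp.continuous_top
  have hg := hbp.topFun_sub_botFun_le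
  obtain ⟨m, hm, hbm, hm'⟩ := hbp.exists_middle hg
  have hmc := (lipschitzWith_half hm).continuous
  have hp := (broken_mem hhb hm hbm).isProfile
  refine ⟨_, hp, ?_⟩
  set Y := heightProfile (broken (botFun hb) m (topFun hb)) with hY
  set F : ℝ → ℝ≥0∞ := (Ioc (0 : ℝ) 2).indicator (fun a => ‖Real.log a‖ₑ) with hF
  have hFm : Measurable F := Real.measurable_log.enorm.indicator measurableSet_Ioc
  have hfst : Measure.QuasiMeasurePreserving (Prod.fst : ℝ × ℝ → ℝ) volume volume :=
    Measure.quasiMeasurePreserving_fst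
  have hne : ∀ a : ℝ, ∀ᵐ z : ℝ × ℝ, z.1 ≠ a := fun a =>
    hfst.ae (show ∀ᵐ x : ℝ, x ≠ a by simp [ae_iff, measure_singleton])
  have hd : ∀ f : ℝ → ℝ, (∀ x x', |f x - f x'| ≤ |x - x'| / 2) →
      ∀ᵐ z : ℝ × ℝ, DifferentiableAt ℝ f z.1 := fun f hf =>
    hfst.ae (lipschitzWith_half hf).ae_differentiableAt_real
  have hbound : ∀ᵐ z : ℝ × ℝ, z ∈ strip (botFun hb) (topFun hb) →
      cost (gradX Y z) (gradY Y z) ≤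
        100 + (2 * F (√2 * z.2 - botFun hb z.1) + 2 * F (1 + topFun hb z.1 - √2 * z.2)) := by
    filter_upwards [hne 0, hne 1, hd _ hbp.lip_bot, hd _ hm, hd _ hbp.lip_top,
      hp.ae_differentiableAt, ae_mul_ne hbc, ae_mul_ne (f := fun x => m x + 1 / 2) (by fun_prop),
      ae_mul_ne (f := fun x => 1 + topFun hb x) (by fun_prop)]
      with z h0 h1 d1 d2 d3 dY n1 n2 n3 ⟨⟨g0, g1⟩, g2, g3⟩
    have hx : z.1 ∈ Ioo (0 : ℝ) 1 := ⟨lt_of_le_of_ne g0 (Ne.symm h0), lt_of_le_of_ne g1 h1⟩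
    have g2' := lt_of_le_of_ne g2 (Ne.symm n1)
    have g3' := lt_of_le_of_ne g3 n3
    have hgz := hg z.1
    rcases lt_or_gt_of_ne n2 with h | h
    · refine (cost_broken_lower hhb hm hbm hm' hg hx g2' h d1 d2 dY).trans ?_
      have : F (√2 * z.2 - botFun hb z.1) = ‖Real.log (√2 * z.2 - botFun hb z.1)‖ₑ :=
        indicator_of_mem (show _ ∈ Ioc (0 : ℝ) 2 from ⟨by linarith, by linarith⟩) _
      rw [this]
      gcongr
      exact le_self_add
    · refine (cost_broken_upper hhb hm hbm hm' hg hx g3' h d3 d2 dY).trans ?_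
      have : F (1 + topFun hb z.1 - √2 * z.2) = ‖Real.log (1 + topFun hb z.1 - √2 * z.2)‖ₑ :=
        indicator_of_mem (show _ ∈ Ioc (0 : ℝ) 2 from ⟨by linarith, by linarith⟩) _
      rw [this]
      gcongr
      exact le_add_self
  have hL := lintegral_log_ne_top
  have hsub : strip (botFun hb) (topFun hb) ⊆ Icc (0 : ℝ) 1 ×ˢ univ := fun z hz => ⟨hz.1, mem_univ _⟩
  -- By Fubini, with a translation or a reflection in `w`, each logarithmic term has the same finite
  -- integral over every vertical line.
  have hfub : ∀ f : ℝ × ℝ → ℝ≥0∞, Measurable f →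
      (∀ x, ∫⁻ w, f (x, w) = ∫⁻ w, F (√2 * w)) → ∫⁻ z in strip (botFun hb) (topFun hb), f z ≠ ⊤ := by
    intro f hf hfx
    refine ne_top_of_le_ne_top ?_ (lintegral_mono_set hsub)
    rw [Measure.volume_eq_prod, ← Measure.prod_restrict, Measure.restrict_univ,
      lintegral_prod _ hf.aemeasurable]
    simp only [hfx, lintegral_const]
    exact ENNReal.mul_ne_top hL (by simp)
  have hm1 : Measurable fun z : ℝ × ℝ => F (√2 * z.2 - botFun hb z.1) := by
    refine hFm.comp (Continuous.measurable ?_); fun_prop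
  have hm2 : Measurable fun z : ℝ × ℝ => F (1 + topFun hb z.1 - √2 * z.2) := by
    refine hFm.comp (Continuous.measurable ?_); fun_prop
  have hI1 := hfub _ hm1 fun x => by
    rw [← lintegral_sub_right_eq_self (fun w => F (√2 * w)) (botFun hb x / √2)]
    refine lintegral_congr fun w => ?_
    congr 1
    field_simp
  have hI2 := hfub _ hm2 fun x => by
    rw [← lintegral_sub_left_eq_self (fun w => F (√2 * w)) ((1 + topFun hb x) / √2)]
    refine lintegral_congr fun w => ?_
    congr 1
    field_simp
  refine ne_top_of_le_ne_top ?_ (lintegral_mono_ae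
    ((ae_restrict_iff' (measurableSet_strip hbc htc)).2 hbound))
  rw [lintegral_add_left measurable_const, lintegral_add_left (hm1.const_mul 2),
    lintegral_const_mul _ hm1, lintegral_const_mul _ hm2, setLIntegral_const]
  exact ENNReal.add_ne_top.2 ⟨ENNReal.mul_ne_top (by simp) hbp.volume_strip_ne_top,
    ENNReal.add_ne_top.2 ⟨ENNReal.mul_ne_top (by simp) hI1, ENNReal.mul_ne_top (by simp) hI2⟩⟩

/-! ### The unique maximizer -/

theorem totalCost_congr {b t : ℝ → ℝ} (hb : Continuous b) (ht : Continuous t) {Y Z : ℝ × ℝ → ℝ}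
    (h : ∀ x ∈ Icc (0 : ℝ) 1, ∀ w, Y (x, w) = Z (x, w)) : totalCost b t Y = totalCost b t Z := by
  refine lintegral_congr_ae ((ae_restrict_iff' (measurableSet_strip hb ht)).2 ?_)
  filter_upwards [ae_mem_nhds_strip hb ht] with z hz hz'
  have hev : Y =ᶠ[𝓝 z] Z := by
    filter_upwards [hz hz'] with y hy
    exact h y.1 hy.1 y.2
  rw [gradX_congr hev, gradY_congr hev]

theorem le_of_ereal_sub_le {v k k₀ : ℝ≥0∞} (hv : v ≠ ⊤) (hk₀ : k₀ ≠ ⊤)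
    (h : (v : EReal) - (k₀ : EReal) ≤ (v : EReal) - (k : EReal)) : k ≤ k₀ := by
  lift v to ℝ≥0 using hv
  lift k₀ to ℝ≥0 using hk₀
  have e : ∀ r : ℝ≥0, ((r : ℝ≥0∞) : EReal) = ((r : ℝ) : EReal) := fun r => rfl
  by_cases hk : k = ⊤
  · rw [hk, EReal.coe_ennreal_top, EReal.sub_top, e, e, ← EReal.coe_sub, le_bot_iff] at h
    exact absurd h (EReal.coe_ne_bot _)
  · lift k to ℝ≥0 using hk
    rw [e, e, e, ← EReal.coe_sub, ← EReal.coe_sub, EReal.coe_le_coe_iff] at h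
    have : (k : ℝ) ≤ k₀ := by linarith
    exact_mod_cast this

/-- The entropy has a unique maximizer among the admissible functions. -/
theorem exists_unique_entropy_max {hb : squareBoundary → ℝ} (hhb : IsBoundaryCondition hb) :
    ∃ h₀ ∈ admissible hb, IsMaxOn (entropy hb) (admissible hb) h₀ ∧
      ∀ h ∈ admissible hb, IsMaxOn (entropy hb) (admissible hb) h → h = h₀ := by
  have hbp := hhb.isBoundaryPair
  have hbc := hbp.continuous_bot
  have htc := hbp.continuous_top
  obtain ⟨R, hR⟩ := hbp.strip_subset
  obtain ⟨Y₁, hY₁, hf₁⟩ := exists_totalCost_ne_top hhb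
  obtain ⟨Y, hY, hmin⟩ := exists_totalCost_minimal hbc htc hR ⟨Y₁, hY₁, hf₁⟩
  have hmem := profileHeight_mem hhb hY
  have hcost := totalCost_congr hbc htc fun x hx w => heightProfile_profileHeight hY hx w
  have hfin : totalCost (botFun hb) (topFun hb) Y ≠ ⊤ := ne_top_of_le_ne_top hf₁ (hmin Y₁ hY₁)
  refine ⟨profileHeight hb Y, hmem, fun h hh => ?_, fun h hh hmax => ?_⟩
  · change entropy hb h ≤ entropy hb (profileHeight hb Y)
    rw [entropy_eq hhb hh, entropy_eq hhb hmem, hcost]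
    exact EReal.sub_le_sub le_rfl (EReal.coe_ennreal_le_coe_ennreal_iff.2 (hmin _ hh.isProfile))
  · have hle : entropy hb (profileHeight hb Y) ≤ entropy hb h := hmax hmem
    rw [entropy_eq hhb hh, entropy_eq hhb hmem, hcost] at hle
    have hle := le_of_ereal_sub_le hbp.volume_strip_ne_top hfin hle
    have hfh := ne_top_of_le_ne_top hfin hle
    -- The midpoint profile costs at least the minimum, which is attained by both profiles, so the
    -- convexity inequality is an equality.
    have hmid : (totalCost (botFun hb) (topFun hb) (heightProfile h) +
        totalCost (botFun hb) (topFun hb) Y) / 2 ≤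
        totalCost (botFun hb) (topFun hb) fun z => (heightProfile h z + Y z) / 2 := by
      refine le_trans ?_ (hmin _ (hh.isProfile.midpoint hY))
      refine (ENNReal.div_le_div_right (add_le_add hle le_rfl) 2).trans (le_of_eq ?_)
      rw [← two_mul, mul_comm, mul_div_assoc, ENNReal.div_self two_ne_zero ENNReal.ofNat_ne_top,
        mul_one]
    have hgrad := gradY_ae_eq_of_minimal hh.isProfile hY hfh hfin hmid
    have heq : ∀ x ∈ Icc (0 : ℝ) 1, ∀ w,
        heightProfile h (x, w) = heightProfile (profileHeight hb Y) (x, w) := fun x hx w => by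
      rw [heightProfile_profileHeight hY hx, eq_of_gradY_ae_eq hbc htc hh.isProfile hY hgrad hx]
    -- Each inequality uses finite cost of the larger function's profile, hence the two appeals.
    refine funext fun p => le_antisymm (le_of_heightProfile_eq hhb hh hmem hfh heq p) ?_
    exact le_of_heightProfile_eq hhb hmem hh (hcost ▸ hfin) (fun x hx w => (heq x hx w).symm) p

end BeadModel

theorem mainTheorem2 (hb : BeadModel.squareBoundary → ℝ) (hhb : BeadModel.IsBoundaryCondition hb) :
    ∃ h₀ ∈ BeadModel.admissible hb,
      (IsMaxOn (BeadModel.entropy hb) (BeadModel.admissible hb) h₀ ∧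
        ∀ h ∈ BeadModel.admissible hb,
          IsMaxOn (BeadModel.entropy hb) (BeadModel.admissible hb) h → h = h₀) ∧
      (BeadModel.turned hb h₀ ∈ BeadModel.turnedAdmissible hb ∧
        IsMaxOn BeadModel.turnedEntropy (BeadModel.turnedAdmissible hb)
          (BeadModel.turned hb h₀) ∧
        ∀ g ∈ BeadModel.turnedAdmissible hb,
          IsMaxOn BeadModel.turnedEntropy (BeadModel.turnedAdmissible hb) g →
            g = BeadModel.turned hb h₀) := by
  obtain ⟨h₀, hh₀, hmax, huniq⟩ := BeadModel.exists_unique_entropy_max hhb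
  refine ⟨h₀, hh₀, ⟨hmax, huniq⟩, ⟨h₀, hh₀, rfl⟩, ?_, ?_⟩
  · rintro _ ⟨h, hh, rfl⟩
    exact hmax hh
  · rintro _ ⟨h, hh, rfl⟩ hg
    rw [huniq h hh fun h' hh' => hg ⟨h', hh', rfl⟩]
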